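/- Let $K$ be a number field with ring of integers $\mathfrak{o}_K$, let $X$ be a smooth, projective, geometrically integral $K$-variety, and let $D\subset X$ be a reduced effective divisor with strict normal crossings whose irreducible components $D_\alpha$ ($\alpha\in\mathcal{A}$) are geometrically irreducible (that is, all irreducible components of $D_{\overline K}$ are defined over $K$). Put $U=X\setminus D$ and $Z_A=\bigcap_{\alpha\in A}D_\alpha$ for $A\subset\mathcal{A}$ (so that $Z_\emptyset=X$). For an archimedean place $v$ of $K$, let $\mathcal{C}^{\mathrm{an}}_v(D)$ be the set of all pairs $(A,Z)$, where $A\subset\mathcal{A}$ and $Z$ is an irreducible component of $(Z_A)_{\overline{K_v}}$ that is defined over $K_v$ and has a $K_v$-rational point, ordered by $(A,Z)\preceq(A',Z')$ if $A\subset A'$ and $Z\supset Z'$. The archimedean analytic Clemens complex is the product $\mathcal{C}^{\mathrm{an}}_\infty(D)=\prod_{v\mid\infty}\mathcal{C}^{\mathrm{an}}_v(D)$ with the product order. For $\boldsymbol{A}=((A_v,Z_v))_{v\mid\infty}\in\mathcal{C}^{\mathrm{an}}_\infty(D)$, let $U_{\boldsymbol{A}}=X\setminus\Delta_{\boldsymbol{A}}$,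 where $\Delta_{\boldsymbol{A}}$ is the union of all $D_\alpha$ such that $\alpha\notin A_v$ for every $v\mid\infty$. Assume that $\mathcal{O}_X(U_{\boldsymbol{A}})\ne K$ for every maximal element $\boldsymbol{A}$ of $\mathcal{C}^{\mathrm{an}}_\infty(D)$. Then, for every integral model $\mathfrak{U}$ of $U$ (that is, every flat and separated $\mathfrak{o}_K$-scheme of finite type together with an isomorphism between its generic fibre and $U$), the set of integral points $\mathfrak{U}(\mathfrak{o}_K)$, regarded as a subset of $U$, is not Zariski dense in $U$. -/

import Mathlib

open CategoryTheory CategoryTheory.Limits AlgebraicGeometry TopologicalSpace NumberField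

universe u

noncomputable section

namespace ClemensObstruction

section General

variable {K : Type u} [Field K]

attribute [local instance] MvPolynomial.gradedAlgebra

/-- A `K`-scheme `f : X ⟶ Spec K` is projective: it admits a closed immersion over `K` into some
projective space `ℙᵐ = Proj K[x₀, …, xₘ]`. -/
def IsProjective {X : Scheme.{u}} (f : X ⟶ Spec (.of K)) : Prop :=
  ∃ (m : ℕ) (i : X ⟶ Proj (MvPolynomial.homogeneousSubmodule (Fin (m + 1)) K)),
    IsClosedImmersion i ∧
      i ≫ Proj.toSpecZero (MvPolynomial.homogeneousSubmodule (Fin (m + 1)) K) ≫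
        Spec.map (CommRingCat.ofHom
          (algebraMap K (MvPolynomial.homogeneousSubmodule (Fin (m + 1)) K 0))) = f

/-- The irreducible components of a closed subset `S` of a topological space, as closed subsets
of the ambient space: the maximal irreducible closed subsets of `S`. -/
def components {T : Type*} [TopologicalSpace T] (S : Closeds T) : Set (Closeds T) :=
  {Z | Maximal (fun W : Closeds T => IsIrreducible (W : Set T) ∧ W ≤ S) Z}

/-- The ideal sheaf of the scheme-theoretic intersection `Z_A` of the closed subsets `α ∈ A` of
`X`, each with its reduced scheme structure. -/
def stratumIdeal {X : Scheme.{u}} (A : Finset (Closeds X)) : X.IdealSheafData :=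
  ⨆ α ∈ A, Scheme.IdealSheafData.vanishingIdeal α

/-- The scheme-theoretic intersection `Z_A` (for `A = ∅` this is `X`). -/
abbrev stratum {X : Scheme.{u}} (A : Finset (Closeds X)) : Scheme.{u} :=
  (stratumIdeal A).subscheme

/-- The closed immersion `Z_A ⟶ X`. -/
abbrev stratumι {X : Scheme.{u}} (A : Finset (Closeds X)) : stratum A ⟶ X :=
  (stratumIdeal A).subschemeι

/-- A reduced effective divisor on a smooth variety is determined by its support, a closed
subset `D`, namely as the sum of the irreducible components `D_α` of `D`.
It has strict normal crossings on the smooth `n`-dimensional variety `X` if the components are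
smooth and intersect transversally: for every finite set `A` of components, the scheme-theoretic
intersection `Z_A` is empty or smooth of dimension `n - #A`. For `#A = 1` this contains that
every component of `D` has codimension one. -/
def IsStrictNormalCrossings {X : Scheme.{u}} (f : X ⟶ Spec (.of K)) (n : ℕ)
    (D : Closeds X) : Prop :=
  ∀ A : Finset (Closeds X), (A : Set (Closeds X)) ⊆ components D → Nonempty (stratum A) →
    ∃ d : ℕ, d + A.card = n ∧ SmoothOfRelativeDimension d (stratumι A ≫ f)

/-- All irreducible components of `D_{K̄}` are defined over `K`: every irreducible component of
`D` is geometrically irreducible. -/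
def HasGeometricallyIrreducibleComponents {X : Scheme.{u}} (f : X ⟶ Spec (.of K))
    (D : Closeds X) : Prop :=
  ∀ α ∈ components D, GeometricallyIrreducible (stratumι {α} ≫ f)

variable (L : Type u) [Field L] [Algebra K L]

/-- The base change `X_L` of a `K`-scheme `X` to a field extension `L` of `K`. -/
abbrev baseChange {X : Scheme.{u}} (f : X ⟶ Spec (.of K)) : Scheme.{u} :=
  pullback f (Spec.map (CommRingCat.ofHom (algebraMap K L)))

/-- The projection `X_L ⟶ X`. -/
abbrev baseChangeFst {X : Scheme.{u}} (f : X ⟶ Spec (.of K)) : baseChange L f ⟶ X :=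
  pullback.fst f (Spec.map (CommRingCat.ofHom (algebraMap K L)))

/-- The structure morphism `X_L ⟶ Spec L`. -/
abbrev baseChangeSnd {X : Scheme.{u}} (f : X ⟶ Spec (.of K)) : baseChange L f ⟶ Spec (.of L) :=
  pullback.snd f (Spec.map (CommRingCat.ofHom (algebraMap K L)))

/-- `X_{L̄}`, constructed as the base change of `X_L` to an algebraic closure of `L`. -/
abbrev geometricBaseChange {X : Scheme.{u}} (f : X ⟶ Spec (.of K)) : Scheme.{u} :=
  baseChange (AlgebraicClosure L) (baseChangeSnd L f)

/-- The projection `X_{L̄} ⟶ X_L`. -/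
abbrev geometricProj {X : Scheme.{u}} (f : X ⟶ Spec (.of K)) :
    geometricBaseChange L f ⟶ baseChange L f :=
  baseChangeFst (AlgebraicClosure L) (baseChangeSnd L f)

/-- The inverse image of a closed subset under a morphism of schemes. -/
def closedPreimage {X Y : Scheme.{u}} (g : X ⟶ Y) (S : Closeds Y) : Closeds X :=
  S.preimage g.continuous

/-- A face of the geometric Clemens complex of `D`: a pair `(A, Z)` of a set `A` of irreducible
components of `D` and an irreducible component `Z` of the geometric stratum
`(⋂_{α ∈ A} D_α)_{L̄}`. (Irreducible components are not affected by extensions of algebraically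
closed fields, so `L̄` may be used here in place of `K̄`.) -/
@[ext]
structure GeometricFace {X : Scheme.{u}} (f : X ⟶ Spec (.of K)) (D : Closeds X) where
  /-- the set of components of `D` -/
  A : Set (Closeds X)
  /-- the component of the geometric stratum -/
  Z : Closeds (geometricBaseChange L f)
  subset_components : A ⊆ components D
  mem_components :
    Z ∈ components (closedPreimage (geometricProj L f ≫ baseChangeFst L f) (sInf A))

/-- The order on faces: `(A, Z) ≤ (A', Z')` if and only if `A ⊆ A'` and `Z ⊇ Z'`. -/
instance {X : Scheme.{u}} (f : X ⟶ Spec (.of K)) (D : Closeds X) :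
    PartialOrder (GeometricFace L f D) where
  le F G := F.A ⊆ G.A ∧ G.Z ≤ F.Z
  le_refl F := ⟨subset_rfl, le_rfl⟩
  le_trans F G H h h' := ⟨h.1.trans h'.1, h'.2.trans h.2⟩
  le_antisymm F G h h' := GeometricFace.ext (h.1.antisymm h'.1) (h'.2.antisymm h.2)

/-- The `L`-analytic Clemens complex of `D`: the faces `(A, Z)` such that `Z` is defined over `L`
(it is the inverse image of a closed subset `Z₀` of `X_L`) and has an `L`-rational point. -/
def analyticClemensComplex {X : Scheme.{u}} (f : X ⟶ Spec (.of K)) (D : Closeds X) :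
    Set (GeometricFace L f D) :=
  {F | ∃ Z₀ : Closeds (baseChange L f), F.Z = closedPreimage (geometricProj L f) Z₀ ∧
    ∃ p : Spec (.of L) ⟶ baseChange L f, p ≫ baseChangeSnd L f = 𝟙 _ ∧
      Set.range p ⊆ (Z₀ : Set (baseChange L f))}

/-- There is a nonconstant regular function on the open subset `V`, that is, `O_X(V) ≠ K`. -/
def HasNonconstantFunction {X : Scheme.{u}} (f : X ⟶ Spec (.of K)) (V : X.Opens) : Prop :=
  ¬ Function.Surjective (f.appLE ⊤ V le_top).hom

end General

section NumberField

variable {K : Type u} [Field K] [NumberField K]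

/-- Tuples `F = (F_v)_{v ∣ ∞}` of geometric faces, with the product order. -/
abbrev FaceTuple {X : Scheme.{u}} (f : X ⟶ Spec (.of K)) (D : Closeds X) : Type u :=
  (v : InfinitePlace K) → GeometricFace v.Completion f D

/-- The archimedean analytic Clemens complex, the product over all archimedean places `v` of the
`K_v`-analytic Clemens complexes. -/
def archimedeanClemensComplex {X : Scheme.{u}} (f : X ⟶ Spec (.of K)) (D : Closeds X) :
    Set (FaceTuple f D) :=
  {F | ∀ v, F v ∈ analyticClemensComplex v.Completion f D}

/-- The complement `Δ_F` of a tuple of faces in `D`: the union of the components of `D` that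
belong to none of the faces `F_v`. (This is a finite union, since `X` is noetherian.) -/
def complementDivisor {X : Scheme.{u}} {f : X ⟶ Spec (.of K)} {D : Closeds X}
    (F : FaceTuple f D) : Closeds X :=
  sSup {α | α ∈ components D ∧ ∀ v, α ∉ (F v).A}

/-- The open subvariety `U_F = X ∖ Δ_F`. -/
def openOfFace {X : Scheme.{u}} {f : X ⟶ Spec (.of K)} {D : Closeds X}
    (F : FaceTuple f D) : X.Opens :=
  (complementDivisor F).compl

/-- The open complement `U = X ∖ D`. -/
def divisorCompl {X : Scheme.{u}} (D : Closeds X) : X.Opens :=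
  D.compl

/-- An integral model of a `K`-scheme `g : U ⟶ Spec K`: a flat and separated scheme of finite type
over the ring of integers, together with an identification of its generic fibre with `U`. -/
structure IntegralModel {U : Scheme.{u}} (g : U ⟶ Spec (.of K)) where
  /-- the model -/
  scheme : Scheme.{u}
  /-- the structure morphism of the model -/
  toBase : scheme ⟶ Spec (.of (𝓞 K))
  flat : Flat toBase
  isSeparated : IsSeparated toBase
  locallyOfFiniteType : LocallyOfFiniteType toBase
  quasiCompact : QuasiCompact toBase
  /-- the morphism from the generic fibre `U` to the model -/
  fromGeneric : U ⟶ scheme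
  isPullback : IsPullback fromGeneric g toBase
    (Spec.map (CommRingCat.ofHom (algebraMap (𝓞 K) K)))

namespace IntegralModel

variable {U : Scheme.{u}} {g : U ⟶ Spec (.of K)} (𝔘 : IntegralModel g)

/-- The set `𝔘(𝓞_K)` of integral points, that is, of sections of `𝔘 ⟶ Spec 𝓞_K`. -/
def IntegralPoint : Type u :=
  {s : Spec (.of (𝓞 K)) ⟶ 𝔘.scheme // s ≫ 𝔘.toBase = 𝟙 _}

/-- The `K`-rational point of `U` given by an integral point: its restriction to the generic
fibre. -/
def IntegralPoint.toRational {𝔘 : IntegralModel g} (s : 𝔘.IntegralPoint) : Spec (.of K) ⟶ U :=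
  𝔘.isPullback.lift (Spec.map (CommRingCat.ofHom (algebraMap (𝓞 K) K)) ≫ s.1) (𝟙 _)
    (by rw [Category.assoc, s.2, Category.comp_id, Category.id_comp])

/-- The set of points of `U` that underlie integral points. -/
def integralLocus : Set U :=
  {x | ∃ s : 𝔘.IntegralPoint, x ∈ Set.range s.toRational}

end IntegralModel

end NumberField

end ClemensObstruction

end

open ClemensObstruction

/-! Suppose the integral points are dense. Fix a nonempty affine open `V` in `U` and consider the
integral points whose generic fibre lies in `V`. By density and integrality of `X` there is an
ultrafilter on them along which only the zero function on `V` vanishes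
(`exists_ultrafilter_evalAt`). As `X` is proper and each `K_v` is locally compact, the points
converge along it to some `P_v` in `X(K_v)` for every archimedean `v` (`exists_limit_point`).

The components of `D` through `P_v` form a face of the analytic Clemens complex
(`exists_mem_analyticClemensComplex`): their intersection is smooth, and a component of a smooth
scheme through a rational point is geometrically irreducible. The resulting tuple of faces lies
below a maximal one `F`, and every `P_v` lies in `U_F`.

Let `g` be a regular function on `U_F`. Near each `P_v` it is `v`-adically bounded. On `U` it is
regular, so a fixed nonzero integer `N` makes `N g` integral at all integral points
(`IntegralModel.exists_integral`). Only finitely many algebraic integers of `K` are bounded at all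
archimedean places, so `N g` is constant along the ultrafilter, hence constant on `V` and then on
`U_F`. This contradicts the existence of a nonconstant function.

Geometric irreducibility is obtained by embedding the local equations at the point in a power series
ring over a polynomial ring, and the limit points come from the valuative criterion for bounded
germs in an ultrapower of `K_v`. -/

noncomputable section

namespace ClemensObstruction

/-! ### Power series expansions at a smooth rational point -/

section PowerSeriesEmbedding

/-- Allows formal smoothness to lift homomorphisms that are given modulo `X ^ 2` only. -/
theorem isAdicComplete_sq {S : Type*} [CommRing S] (I : Ideal S) [IsAdicComplete I S] :
    IsAdicComplete (I ^ 2) S where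
  haus' x hx := IsHausdorff.haus (I := I) inferInstance x fun n ↦ by
    refine (hx n).mono ?_
    rw [← pow_mul]
    exact Submodule.smul_mono_left (Ideal.pow_le_pow_right (by omega))
  prec' g hg := by
    obtain ⟨l, hl⟩ := IsPrecomplete.prec (I := I) inferInstance (f := g) fun {m n} h ↦ by
      refine (hg h).mono ?_
      rw [← pow_mul]
      exact Submodule.smul_mono_left (Ideal.pow_le_pow_right (by omega))
    -- The limit `l` is known only modulo `I ^ n` at index `n`, so `g n` is first compared with `g
    -- (2 * n)`.
    refine ⟨l, fun n ↦ (hg (show n ≤ 2 * n by omega)).trans ?_⟩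
    rw [← pow_mul]
    exact hl (2 * n)

open PowerSeries in
/-- A derivation at a rational point of a formally smooth algebra is the linear term of a
homomorphism to a power series ring. -/
theorem exists_algHom_powerSeries_coeff_one {k R M : Type u} [Field k] [CommRing R] [Algebra k R]
    [Algebra.FormallySmooth k R] [CommRing M] [Algebra k M] (ε : R →ₐ[k] k) (D : R →ₗ[k] M)
    (hD1 : D 1 = 0) (hDmul : ∀ a c, D (a * c) = ε a • D c + ε c • D a) :
    ∃ ψ : R →ₐ[k] PowerSeries M, (∀ a, coeff 0 (ψ a) = algebraMap k M (ε a)) ∧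
      ∀ a, coeff 1 (ψ a) = D a := by
  let J : Ideal (PowerSeries M) := Ideal.span {(X : PowerSeries M)} ^ 2
  have : IsAdicComplete J (PowerSeries M) := isAdicComplete_sq _
  let F : R →ₗ[k] PowerSeries M := (Algebra.linearMap k (PowerSeries M)) ∘ₗ ε.toLinearMap +
    (LinearMap.mulLeft k (X : PowerSeries M)) ∘ₗ
      (IsScalarTower.toAlgHom k M (PowerSeries M)).toLinearMap ∘ₗ D
  have hF (a : R) : F a = C (algebraMap k M (ε a)) + X * C (D a) := by
    simp [F, PowerSeries.algebraMap_apply]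
  -- By the Leibniz rule, `ε + X D` is multiplicative modulo `X ^ 2`, the error being `D a * D c * X
  -- ^ 2`.
  let φ : R →ₐ[k] PowerSeries M ⧸ J :=
    AlgHom.ofLinearMap ((Ideal.Quotient.mkₐ k J).toLinearMap ∘ₗ F)
    (by simp [hF, hD1]) (by
      intro a c
      change Ideal.Quotient.mk J (F (a * c)) = Ideal.Quotient.mk J (F a) * Ideal.Quotient.mk J (F c)
      rw [← map_mul, Ideal.Quotient.mk_eq_mk_iff_sub_mem]
      have : F (a * c) - F a * F c = X ^ 2 * (- (C (D a) * C (D c))) := by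
        simp only [hF, hDmul, map_add, map_mul, Algebra.smul_def]
        ring
      rw [this]
      exact Ideal.mul_mem_right _ _ (Ideal.pow_mem_pow (Ideal.mem_span_singleton_self _) 2))
  obtain ⟨ψ, hψ⟩ := Algebra.FormallySmooth.exists_mkₐ_comp_eq_of_isAdicComplete φ
  have hψF (a : R) : ∀ n < 2, coeff n (ψ a) = coeff n (F a) := by
    have h1 : Ideal.Quotient.mk J (ψ a) = Ideal.Quotient.mk J (F a) := congr($hψ a)
    rw [Ideal.Quotient.mk_eq_mk_iff_sub_mem, show J = Ideal.span {(X : PowerSeries M) ^ 2} from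
      Ideal.span_singleton_pow _ _, Ideal.mem_span_singleton, X_pow_dvd_iff] at h1
    intro n hn
    simpa [sub_eq_zero] using h1 n hn
  refine ⟨ψ, fun a ↦ ?_, fun a ↦ ?_⟩
  · rw [hψF a 0 (by simp), hF]
    simp
  · rw [hψF a 1 (by simp), hF, show (1 : ℕ) = 0 + 1 from rfl, map_add, coeff_succ_X_mul]
    simp [coeff_C]

/-- The universal derivation at a rational point, written in terms of a basis. -/
theorem exists_derivation_mvPolynomial {k R : Type u} [Field k] [CommRing R] [Algebra k R]
    (ε : R →ₐ[k] k) : ∃ (ι : Type u) (D : R →ₗ[k] MvPolynomial ι k) (y : ι → R),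
      D 1 = 0 ∧ (∀ a c, D (a * c) = ε a • D c + ε c • D a) ∧
      ∀ a ∈ RingHom.ker ε, a - MvPolynomial.aeval y (D a) ∈ RingHom.ker ε ^ 2 := by
  set m : Ideal R := RingHom.ker ε with hm
  -- A basis of all of `R ⧸ m ^ 2` avoids choosing one of `m ⧸ m ^ 2`; the projection `δ` onto `m`
  -- discards the constants.
  let b := Module.Basis.ofVectorSpace k (R ⧸ m ^ 2)
  let ι := Module.Basis.ofVectorSpaceIndex k (R ⧸ m ^ 2)
  let ℓ : (R ⧸ m ^ 2) →ₗ[k] MvPolynomial ι k := b.constr k fun i ↦ MvPolynomial.X i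
  let δ : R →ₗ[k] R := LinearMap.id - (Algebra.linearMap k R) ∘ₗ ε.toLinearMap
  have hδ (a : R) : δ a = a - algebraMap k R (ε a) := rfl
  have hδm (a : R) : δ a ∈ m := by simp [hm, hδ, RingHom.mem_ker]
  have hδmem {a : R} (ha : a ∈ m) : δ a = a := by
    have : ε a = 0 := ha
    simp [hδ, this]
  let q : R →ₗ[k] R ⧸ m ^ 2 := (Ideal.Quotient.mkₐ k (m ^ 2)).toLinearMap
  have hq {a : R} (ha : a ∈ m ^ 2) : q a = 0 := Ideal.Quotient.eq_zero_iff_mem.mpr ha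
  let D : R →ₗ[k] MvPolynomial ι k := ℓ ∘ₗ q ∘ₗ δ
  have hD (a : R) : D a = ℓ (q (δ a)) := rfl
  choose r hr using fun i ↦ Ideal.Quotient.mk_surjective (I := m ^ 2) (b i)
  let y : ι → R := fun i ↦ δ (r i)
  refine ⟨ι, D, y, by simp [hD, hδ], fun a c ↦ ?_, fun a ha ↦ ?_⟩
  · have h : δ (a * c) = ε a • δ c + ε c • δ a + δ a * δ c := by
      simp only [hδ, map_mul, Algebra.smul_def]; ring
    have h0 : q (δ a * δ c) = 0 := hq (by
      rw [pow_two]; exact Ideal.mul_mem_mul (hδm a) (hδm c))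
    simp only [hD, h, map_add, map_smul, h0, add_zero]
  · let σ : (R ⧸ m ^ 2) →ₗ[k] R := b.constr k r
    have hσ : q ∘ₗ σ = LinearMap.id := b.ext fun i ↦ by
      rw [LinearMap.comp_apply, Module.Basis.constr_basis]
      exact hr i
    have h2 : q ∘ₗ (MvPolynomial.aeval y).toLinearMap ∘ₗ ℓ = q ∘ₗ δ ∘ₗ σ := by
      refine b.ext fun i ↦ ?_
      have h3 : ℓ (b i) = MvPolynomial.X i := Module.Basis.constr_basis _ _ _ _
      have h4 : σ (b i) = r i := Module.Basis.constr_basis _ _ _ _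
      simp only [LinearMap.comp_apply]
      rw [h3, h4]
      exact congr_arg q (MvPolynomial.aeval_X y i)
    have h5 : σ (q a) - a ∈ m ^ 2 := by
      rw [← Ideal.Quotient.eq_zero_iff_mem]
      change q _ = 0
      rw [map_sub, sub_eq_zero]
      exact congr($hσ (q a))
    have h3 : q (MvPolynomial.aeval y (D a)) = q a := by
      have h4 : q (MvPolynomial.aeval y (ℓ (q a))) = q (δ (σ (q a))) := congr($h2 (q a))
      rw [hD, hδmem ha, h4]
      have h6 : δ (σ (q a)) - a = σ (q a) - a := by
        have := hδmem (Ideal.pow_le_self two_ne_zero h5)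
        rwa [map_sub, hδmem ha] at this
      have h7 := hq (h6 ▸ h5)
      rwa [map_sub, sub_eq_zero] at h7
    rw [← Ideal.Quotient.eq_zero_iff_mem, map_sub, sub_eq_zero]
    exact h3.symm

open PowerSeries in
/-- A formally smooth algebra with a rational point maps to a power series ring in such a way that
elements of the kernel vanish to infinite order at the point. -/
theorem exists_algHom_powerSeries {k R : Type u} [Field k] [CommRing R] [Algebra k R]
    [Algebra.FormallySmooth k R] (ε : R →ₐ[k] k) :
    ∃ (ι : Type u) (ψ : R →ₐ[k] PowerSeries (MvPolynomial ι k)),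
      (∀ a, coeff 0 (ψ a) = MvPolynomial.C (ε a)) ∧
      ∀ a, ψ a = 0 → ∀ n, a ∈ RingHom.ker ε ^ n := by
  obtain ⟨ι, D, y, hD1, hDmul, hdeg1⟩ := exists_derivation_mvPolynomial ε
  obtain ⟨ψ, hψ0, hψ1⟩ := exists_algHom_powerSeries_coeff_one ε D hD1 hDmul
  refine ⟨ι, ψ, hψ0, ?_⟩
  set m : Ideal R := RingHom.ker ε with hm
  -- On `m ^ n` the `n`-th coefficient of `ψ` is a leading form: evaluating it at `y` recovers the
  -- element modulo `m ^ (n + 1)`. Leading forms multiply, which gives the induction along `m ^ (n +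
  -- 1) = m ^ n * m`.
  have key (n : ℕ) : ∀ a ∈ m ^ n, (∀ j < n, coeff j (ψ a) = 0) ∧
      a - MvPolynomial.aeval y (coeff n (ψ a)) ∈ m ^ (n + 1) := by
    induction n with
    | zero =>
      intro a _
      refine ⟨by simp, ?_⟩
      rw [hψ0, AlgHom.commutes, zero_add, pow_one, hm, RingHom.mem_ker, map_sub, AlgHom.commutes]
      exact sub_self _
    | succ n ih =>
      intro a ha
      rw [pow_succ] at ha
      refine Submodule.mul_induction_on ha (fun c hc d hd ↦ ?_) fun c d hc hd ↦ ?_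
      · obtain ⟨h1, h2⟩ := ih c hc
        have h3 := hdeg1 d hd
        have hd0 : ε d = 0 := hd
        obtain ⟨u, hu⟩ := X_pow_dvd_iff.mpr h1
        obtain ⟨w, hw⟩ := X_dvd_iff.mpr (show constantCoeff (ψ d) = 0 by
          rw [← coeff_zero_eq_constantCoeff_apply, hψ0, hd0, map_zero])
        have hprod : ψ (c * d) = X ^ (n + 1) * (u * w) := by
          rw [map_mul, hu, hw]; ring
        have hcn : coeff n (ψ c) = coeff 0 u := by
          rw [hu]; simpa using coeff_X_pow_mul u n 0
        have hd1 : D d = coeff 0 w := by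
          rw [← hψ1, hw]; exact coeff_succ_X_mul 0 w
        have hcd : coeff (n + 1) (ψ (c * d)) = coeff n (ψ c) * D d := by
          rw [hprod, hcn, hd1]
          simpa using coeff_X_pow_mul (u * w) (n + 1) 0
        refine ⟨X_pow_dvd_iff.mp ⟨_, hprod⟩, ?_⟩
        rw [hcd, map_mul]
        generalize MvPolynomial.aeval y (coeff n (ψ c)) = P at h2 ⊢
        generalize MvPolynomial.aeval y (D d) = Q at h3 ⊢
        have hP : P ∈ m ^ n := by
          have := Ideal.pow_le_pow_right (I := m) (Nat.le_succ n) h2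
          simpa using sub_mem hc this
        have : c * d - P * Q = (c - P) * d + P * (d - Q) := by ring
        rw [this]
        refine add_mem ?_ ?_
        · rw [pow_succ _ (n + 1)]; exact Ideal.mul_mem_mul h2 hd
        · rw [show n + 1 + 1 = n + 2 from rfl, pow_add]; exact Ideal.mul_mem_mul hP h3
      · refine ⟨fun j hj ↦ by rw [map_add, map_add, hc.1 j hj, hd.1 j hj, add_zero], ?_⟩
        rw [map_add, map_add, map_add, add_sub_add_comm]
        exact add_mem hc.2 hd.2
  intro a ha n
  induction n with
  | zero => simp
  | succ n ih =>
    have := (key n a ih).2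
    rwa [ha, map_zero, map_zero, sub_zero] at this

/-- The kernel of the localization of a ring at the kernel of a ring homomorphism to a field is
the kernel of a map to a power series ring, if the ring is smooth at this point. -/
theorem exists_algHom_powerSeries_ker {k R : Type u} [Field k] [CommRing R] [Algebra k R]
    [IsNoetherianRing R] [Algebra.FormallySmooth k R] (ε : R →ₐ[k] k) :
    ∃ (ι : Type u) (ψ : R →ₐ[k] PowerSeries (MvPolynomial ι k)),
      (∀ a, ψ a = 0 → ε a = 0) ∧ ∀ a, ψ a = 0 → ∃ s, ε s ≠ 0 ∧ s * a = 0 := by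
  obtain ⟨ι, ψ, h0, h⟩ := exists_algHom_powerSeries ε
  refine ⟨ι, ψ, fun a ha ↦ ?_, fun a ha ↦ ?_⟩
  · have := h0 a
    rw [ha, map_zero] at this
    exact MvPolynomial.C_injective ι k (by rw [← this, map_zero])
  -- Krull's intersection theorem: an element of all powers of the kernel is fixed by some `r` in
  -- the kernel, so `1 - r` kills it.
  · obtain ⟨r, hr⟩ := (Ideal.mem_iInf_smul_pow_eq_bot_iff (RingHom.ker ε) a).mp
      ((Submodule.mem_iInf _).mpr fun n ↦ by simpa using h a ha n)
    have hr0 : ε r = 0 := r.2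
    refine ⟨1 - r, by simp [hr0], ?_⟩
    rw [sub_mul, one_mul, ← smul_eq_mul, hr, sub_self]

open PowerSeries TensorProduct in
/-- A subalgebra of a power series ring over a polynomial ring over a field remains a domain after
every extension of the ground field. -/
theorem isDomain_tensorProduct_of_injective_powerSeries {k C ι : Type*} [Field k] [CommRing C]
    [Algebra k C] (ψ : C →ₐ[k] PowerSeries (MvPolynomial ι k)) (hψ : Function.Injective ψ)
    (E : Type*) [Field E] [Algebra k E] : IsDomain (E ⊗[k] C) := by
  let θ : PowerSeries (MvPolynomial ι k) →+* PowerSeries (MvPolynomial ι E) :=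
    PowerSeries.map (MvPolynomial.map (algebraMap k E))
  let θ' : PowerSeries (MvPolynomial ι k) →ₐ[k] PowerSeries (MvPolynomial ι E) :=
    { θ with
      commutes' := fun r ↦ by
        simp [θ, IsScalarTower.algebraMap_apply k (MvPolynomial ι k) (PowerSeries _),
          IsScalarTower.algebraMap_apply k (MvPolynomial ι E) (PowerSeries _),
          MvPolynomial.algebraMap_eq,
          MvPolynomial.algebraMap_apply] }
  let Φ : E ⊗[k] C →ₐ[k] PowerSeries (MvPolynomial ι E) :=
    Algebra.TensorProduct.lift (IsScalarTower.toAlgHom k E _) (θ'.comp ψ) fun _ _ ↦ .all _ _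
  suffices h : Function.Injective Φ from h.isDomain Φ.toRingHom
  classical
  -- Expand along a `k`-basis of `E`. Coefficients of `ψ` lie in `k`, so linear independence can be
  -- applied to each monomial separately.
  let b := Module.Basis.ofVectorSpace k E
  rw [injective_iff_map_eq_zero]
  intro x hx
  let e := TensorProduct.equivFinsuppOfBasisLeft (N := C) b
  obtain ⟨c, rfl⟩ := e.symm.surjective x
  have hc : e.symm c = c.sum fun i n ↦ b i ⊗ₜ n :=
    TensorProduct.equivFinsuppOfBasisLeft_symm_apply _ _
  suffices c = 0 by rw [this, map_zero]
  ext i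
  rw [Finsupp.zero_apply]
  apply hψ
  rw [map_zero]
  ext n s
  have h1 := congr(MvPolynomial.coeff s (coeff n $hx))
  have h2 : ∀ (z : E) (w : C), MvPolynomial.coeff s (coeff n (Φ (z ⊗ₜ w))) =
      MvPolynomial.coeff s (coeff n (ψ w)) • z := by
    intro z w
    have : Φ (z ⊗ₜ w) = algebraMap E _ z * θ (ψ w) := Algebra.TensorProduct.lift_tmul ..
    rw [this, IsScalarTower.algebraMap_apply E (MvPolynomial ι E) (PowerSeries _),
      PowerSeries.algebraMap_apply, Algebra.algebraMap_self_apply, coeff_C_mul,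
      MvPolynomial.algebraMap_eq, MvPolynomial.coeff_C_mul, PowerSeries.coeff_map,
      MvPolynomial.coeff_map, mul_comm, Algebra.smul_def]
  rw [hc, Finsupp.sum, map_sum, map_sum, MvPolynomial.coeff_sum] at h1
  simp only [h2, map_zero, MvPolynomial.coeff_zero] at h1
  have h3 := linearIndependent_iff'.mp b.linearIndependent _ _ h1
  by_cases hi : i ∈ c.support
  · simpa using h3 i hi
  · rw [Finsupp.notMem_support_iff.mp hi]; simp

end PowerSeriesEmbedding

/-! ### Components through a smooth rational point -/

section SmoothPoint

open TensorProduct in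
/-- An irreducible component through a rational point of a smooth scheme is the closure of an
affine integral subscheme that remains integral after every extension of the ground field. -/
theorem exists_component_of_smooth {L : Type u} [Field L] {Y : Scheme.{u}}
    (g : Y ⟶ Spec (.of L)) [Smooth g] (p : Spec (.of L) ⟶ Y) (hp : p ≫ g = 𝟙 _) :
    ∃ (C : Type u) (_ : CommRing C) (_ : Algebra L C) (j : Spec (.of C) ⟶ Y),
      j ≫ g = Spec.map (CommRingCat.ofHom (algebraMap L C)) ∧
      (∀ (E : Type u) [Field E] [Algebra L E], IsDomain (E ⊗[L] C)) ∧
      Set.range p ⊆ closure (Set.range j) ∧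
      ∀ T : Set Y, IsIrreducible T → IsClosed T → Set.range j ⊆ T → T ⊆ closure (Set.range j) := by
  let x₀ : Spec (.of L) := IsLocalRing.closedPoint L
  have hrange : Set.range p = {p x₀} := by
    rw [Set.range_eq_singleton_iff]
    exact fun y ↦ congr_arg p (Subsingleton.elim (α := PrimeSpectrum L) y x₀)
  obtain ⟨_, ⟨V, hV, rfl⟩, hxV, -⟩ :=
    Y.isBasis_affineOpens.exists_subset_of_mem_open (Set.mem_univ (p x₀)) isOpen_univ
  replace hV : IsAffineOpen V := hV
  let R := Γ(Y, V)
  obtain ⟨φ, hφ⟩ := Spec.map_surjective (hV.fromSpec ≫ g)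
  have hsm : φ.hom.Smooth := by
    rw [← HasRingHomProperty.Spec_iff (P := @Smooth), hφ]
    infer_instance
  let _ : Algebra L R := φ.hom.toAlgebra
  have hφ' : φ = CommRingCat.ofHom (algebraMap L R) := rfl
  have : Algebra.Smooth L R := hsm
  have : IsNoetherianRing R := Algebra.FiniteType.isNoetherianRing L R
  have hpV : Set.range p ⊆ Set.range hV.fromSpec := by
    rw [hrange, hV.range_fromSpec]
    simpa using hxV
  obtain ⟨e, he⟩ := Spec.map_surjective (IsOpenImmersion.lift hV.fromSpec p hpV)
  have hep : Spec.map e ≫ hV.fromSpec = p := by rw [he, IsOpenImmersion.lift_fac]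
  have heφ : φ ≫ e = 𝟙 _ := by
    apply Spec.map_injective
    rw [Spec.map_comp, hφ, reassoc_of% hep, hp, Spec.map_id]
  let ε : R →ₐ[L] L :=
    { e.hom with commutes' := fun r ↦ congr($(heφ).hom r) }
  obtain ⟨ι, ψ, h0, h1⟩ := exists_algHom_powerSeries_ker ε
  let P : Ideal R := RingHom.ker ψ
  let C := R ⧸ P
  let j₀ : Spec (.of C) ⟶ Spec R := Spec.map (CommRingCat.ofHom (Ideal.Quotient.mk P))
  have hP : P.IsPrime := RingHom.ker_isPrime _
  have hrj₀ : Set.range j₀ = closure {(⟨P, hP⟩ : PrimeSpectrum R)} := by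
    rw [PrimeSpectrum.closure_singleton]
    exact (range_comap_of_surjective _ _ Ideal.Quotient.mk_surjective).trans
      (by rw [Ideal.mk_ker])
  refine ⟨C, inferInstance, inferInstance, j₀ ≫ hV.fromSpec, ?_, ?_, ?_, ?_⟩
  · rw [Category.assoc, ← hφ, ← Spec.map_comp]
    rfl
  · intro E _ _
    exact isDomain_tensorProduct_of_injective_powerSeries (Ideal.kerLiftAlg ψ)
      (Ideal.kerLiftAlg_injective ψ) E
  · refine Set.Subset.trans ?_ subset_closure
    rw [← hep, Scheme.Hom.comp_base, Scheme.Hom.comp_base, TopCat.coe_comp, TopCat.coe_comp,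
      Set.range_comp, Set.range_comp]
    refine Set.image_mono ?_
    rw [hrj₀, PrimeSpectrum.closure_singleton]
    rintro _ ⟨z, rfl⟩
    intro a ha
    change e.hom a ∈ z.asIdeal
    rw [show e.hom a = 0 from h0 a ha]
    exact zero_mem _
  · intro T hT hTc hjT
    obtain ⟨t, ht⟩ := QuasiSober.sober hT hTc
    let η : Spec R := ⟨P, hP⟩
    have hηj : hV.fromSpec η ∈ Set.range (j₀ ≫ hV.fromSpec) := by
      rw [Scheme.Hom.comp_base, TopCat.coe_comp, Set.range_comp, hrj₀]
      exact ⟨η, subset_closure rfl, rfl⟩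
    have htη : t ⤳ hV.fromSpec η := ht.specializes (hjT hηj)
    have htV : t ∈ Set.range hV.fromSpec :=
      htη.mem_open hV.fromSpec.isOpenEmbedding.isOpen_range ⟨η, rfl⟩
    obtain ⟨t', rfl⟩ := htV
    have ht'η : t' ⤳ η := hV.fromSpec.isOpenEmbedding.isInducing.specializes_iff.mp htη
    have hle : t'.asIdeal ≤ P := (PrimeSpectrum.le_iff_specializes t' η).mpr ht'η
    -- An element of `P` is killed by some `s` not vanishing at the rational point, hence `s ∉ t'`
    -- because `t' ≤ P ≤ ker ε`. Thus `P` is the only minimal prime through the point.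
    have hge : P ≤ t'.asIdeal := by
      intro a ha
      obtain ⟨s, hs, hsa⟩ := h1 a ha
      refine (t'.isPrime.mem_or_mem (hsa ▸ zero_mem _ : s * a ∈ t'.asIdeal)).resolve_left ?_
      exact fun h ↦ hs (h0 s (hle h))
    have heq : t' = η := PrimeSpectrum.ext (le_antisymm hle hge)
    rw [← ht.def, heq]
    exact closure_mono (Set.singleton_subset_iff.mpr hηj)

open TensorProduct in
/-- If `C` remains a domain after extension of scalars to `E`, then the inverse image in `X_E` of
the image of `Spec C` in `X` is irreducible. -/
theorem isIrreducible_preimage_range {L : Type u} [Field L] {X : Scheme.{u}}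
    (h : X ⟶ Spec (.of L)) {C : Type u} [CommRing C] [Algebra L C] (j : Spec (.of C) ⟶ X)
    (hj : j ≫ h = Spec.map (CommRingCat.ofHom (algebraMap L C))) (E : Type u) [Field E]
    [Algebra L E] [IsDomain (E ⊗[L] C)] :
    IsIrreducible (baseChangeFst E h ⁻¹' closure (Set.range j)) := by
  have hopen : IsOpenMap (baseChangeFst E h) := (baseChangeFst E h).isOpenMap
  rw [hopen.preimage_closure_eq_closure_preimage (baseChangeFst E h).continuous]
  refine IsIrreducible.closure ?_
  rw [← Scheme.Pullback.range_fst]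
  have e : pullback (baseChangeFst E h) j ≅ Spec (.of (E ⊗[L] C)) :=
    pullbackSymmetry _ _ ≪≫ pullbackRightPullbackFstIso _ _ _ ≪≫
      pullback.congrHom hj rfl ≪≫ pullbackSymmetry _ _ ≪≫ pullbackSpecIso L E C
  have : IrreducibleSpace (Spec (.of (E ⊗[L] C))) := inferInstance
  have hr : Set.range (pullback.fst (baseChangeFst E h) j) =
      (e.inv ≫ pullback.fst (baseChangeFst E h) j) '' Set.univ := by
    rw [Set.image_univ, Scheme.Hom.comp_base, TopCat.coe_comp]
    exact (e.inv.homeomorph.surjective.range_comp _).symm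
  rw [hr]
  exact (IrreducibleSpace.isIrreducible_univ _).image _ (Scheme.Hom.continuous _).continuousOn

end SmoothPoint

/-! ### The face attached to a local point -/

section Faces

theorem finite_components {T : Type*} [TopologicalSpace T] [NoetherianSpace T] (S : Closeds T) :
    (components S).Finite := by
  obtain ⟨s, hs, hS⟩ := NoetherianSpace.exists_finset_irreducible S
  refine s.finite_toSet.subset fun Z hZ ↦ ?_
  obtain ⟨⟨hZi, hZS⟩, hmax⟩ := hZ
  have hcov : (Z : Set T) ⊆ ⋃ W ∈ s, (W : Set T) := by
    intro x hx
    have hx' : x ∈ s.sup id := hS ▸ hZS hx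
    rw [← SetLike.mem_coe, Closeds.coe_finset_sup] at hx'
    simpa using hx'
  obtain ⟨W, hW, hZW⟩ : ∃ W ∈ s, Z ≤ W := by
    by_contra! h
    have := (isIrreducible_iff_sUnion_isClosed.mp hZi) (s.image fun W : Closeds T ↦ (W : Set T))
      (by simpa using fun W _ ↦ W.isClosed) (by simpa using hcov)
    obtain ⟨t, ht, hZt⟩ := this
    obtain ⟨W, hW, rfl⟩ := Finset.mem_image.mp ht
    exact h W hW hZt
  have hWS : W ≤ S := hS ▸ Finset.le_sup (f := id) hW
  exact (le_antisymm hZW (hmax ⟨hs ⟨W, hW⟩, hWS⟩ hZW)) ▸ hW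

/-- As `Y` is reduced, the kernel is radical, so a set-theoretic inclusion of images suffices to
factor through a reduced closed subscheme. -/
theorem vanishingIdeal_le_ker {X Y : Scheme.{u}} [IsReduced Y] (P : Y ⟶ X) [QuasiCompact P]
    (α : Closeds X) (h : Set.range P ⊆ α) : Scheme.IdealSheafData.vanishingIdeal α ≤ P.ker := by
  have h1 : P.ker.support ≤ α := by
    intro x hx
    have hx' : x ∈ (P.ker.support : Set X) := hx
    rw [Scheme.Hom.support_ker] at hx'
    exact closure_minimal h α.isClosed hx'
  refine (Scheme.IdealSheafData.vanishingIdeal_antimono h1).trans ?_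
  rw [Scheme.IdealSheafData.vanishingIdeal_support, Scheme.IdealSheafData.le_def]
  rintro U x ⟨m, hm⟩
  rw [Scheme.Hom.ker_apply, RingHom.mem_ker] at hm ⊢
  rw [map_pow] at hm
  exact eq_zero_of_pow_eq_zero hm

theorem range_stratumι {X : Scheme.{u}} (A : Finset (Closeds X)) :
    Set.range (stratumι A) = (sInf (A : Set (Closeds X)) : Closeds X) := by
  rw [Scheme.IdealSheafData.range_subschemeι]
  congr 1
  apply le_antisymm
  · refine le_sInf fun α hα ↦ ?_
    have h : Scheme.IdealSheafData.vanishingIdeal α ≤ stratumIdeal A :=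
      le_iSup₂_of_le α hα le_rfl
    refine (Scheme.IdealSheafData.support_antitone h).trans (le_of_eq ?_)
    ext; simp
  · rw [Scheme.IdealSheafData.le_support_iff_le_vanishingIdeal]
    exact iSup₂_le fun α hα ↦ Scheme.IdealSheafData.vanishingIdeal_antimono (sInf_le hα)

variable {K : Type u} [Field K] (L : Type u) [Field L] [Algebra K L]

instance surjective_spec_map_algebraMap (F E : Type u) [Field F] [Field E] [Algebra F E] :
    Surjective (Spec.map (CommRingCat.ofHom (algebraMap F E))) :=
  ⟨fun _ ↦ ⟨IsLocalRing.closedPoint E, Subsingleton.elim (α := PrimeSpectrum F) _ _⟩⟩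

/-- A rational point of `X` over an extension `L` of the ground field defines a face of the
`L`-analytic Clemens complex. -/
theorem exists_mem_analyticClemensComplex {X : Scheme.{u}} [NoetherianSpace X]
    (f : X ⟶ Spec (.of K)) (n : ℕ) (D : Closeds X)
    (hsnc : IsStrictNormalCrossings f n D) (P : Spec (.of L) ⟶ X)
    (hP : P ≫ f = Spec.map (CommRingCat.ofHom (algebraMap K L))) :
    ∃ F ∈ analyticClemensComplex L f D, ∀ α ∈ components D, Set.range P ⊆ α → α ∈ F.A := by
  let A₀ : Set (Closeds X) := {α ∈ components D | Set.range P ⊆ α}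
  have hA₀ : A₀.Finite := (finite_components D).subset fun α h ↦ h.1
  let A : Finset (Closeds X) := hA₀.toFinset
  have hA : (A : Set (Closeds X)) = A₀ := hA₀.coe_toFinset
  have hker : (stratumι A).ker ≤ P.ker := by
    rw [Scheme.IdealSheafData.ker_subschemeι]
    refine iSup₂_le fun α hα ↦ vanishingIdeal_le_ker P α ?_
    exact (hA₀.mem_toFinset.mp hα).2
  let q : Spec (.of L) ⟶ stratum A := IsClosedImmersion.lift (stratumι A) P hker
  have hq : q ≫ stratumι A = P := IsClosedImmersion.lift_fac _ _ hker
  have hsm : Smooth (stratumι A ≫ f) := by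
    obtain ⟨d, -, h⟩ := hsnc A (fun α hα ↦ (hA₀.mem_toFinset.mp hα).1)
      ⟨q (IsLocalRing.closedPoint L)⟩
    exact SmoothOfRelativeDimension.smooth d _
  let Y := pullback (stratumι A) (baseChangeFst L f)
  let i : Y ⟶ baseChange L f := pullback.snd _ _
  have hi : Set.range i = baseChangeFst L f ⁻¹' Set.range (stratumι A) :=
    Scheme.Pullback.range_snd (stratumι A) (baseChangeFst L f)
  have hpb : IsPullback (pullback.fst _ _) (i ≫ baseChangeSnd L f) (stratumι A ≫ f)
      (Spec.map (CommRingCat.ofHom (algebraMap K L))) :=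
    (IsPullback.of_hasPullback (stratumι A) (baseChangeFst L f)).flip.paste_horiz
      (IsPullback.of_hasPullback f _).flip |>.flip
  have : Smooth (i ≫ baseChangeSnd L f) := MorphismProperty.of_isPullback hpb hsm
  let pL : Spec (.of L) ⟶ baseChange L f := pullback.lift P (𝟙 _) (by simp [hP])
  have hpL : pL ≫ baseChangeSnd L f = 𝟙 _ := pullback.lift_snd _ _ _
  let p : Spec (.of L) ⟶ Y := pullback.lift q pL (by rw [hq]; exact (pullback.lift_fst _ _ _).symm)
  have hp : p ≫ i = pL := pullback.lift_snd _ _ _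
  obtain ⟨C, _, _, j, hj, hC, hpj, hmax⟩ := exists_component_of_smooth (i ≫ baseChangeSnd L f) p
    (by rw [reassoc_of% hp, hpL])
  have himage (S : Set Y) (hS : IsClosed S) : IsClosed (i '' S) :=
    i.isClosedEmbedding.isClosedMap S hS
  -- Building the component over `L` first makes its being defined over `L` automatic;
  -- irreducibility over the closure comes from `hC`.
  let Z₀ : Closeds (baseChange L f) := ⟨closure (Set.range (j ≫ i)), isClosed_closure⟩
  have hZ₀ : (Z₀ : Set (baseChange L f)) = i '' closure (Set.range j) := by
    change closure _ = _
    rw [← i.isClosedEmbedding.closure_image_eq, Scheme.Hom.comp_base, TopCat.coe_comp,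
      Set.range_comp]
  have hD := hC (AlgebraicClosure L)
  have hZ : IsIrreducible (closedPreimage (geometricProj L f) Z₀ : Set (geometricBaseChange L f)) :=
    isIrreducible_preimage_range (baseChangeSnd L f) (j ≫ i)
      (by rw [Category.assoc, hj]) (AlgebraicClosure L)
  have hle : closedPreimage (geometricProj L f) Z₀ ≤
      closedPreimage (geometricProj L f ≫ baseChangeFst L f) (sInf A₀) := by
    intro x hx
    have h1 : geometricProj L f x ∈ (Z₀ : Set (baseChange L f)) := hx
    rw [hZ₀] at h1
    have h2 : geometricProj L f x ∈ Set.range i := Set.image_subset_range _ _ h1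
    rw [hi, range_stratumι, hA] at h2
    exact h2
  refine ⟨⟨A₀, closedPreimage (geometricProj L f) Z₀, fun α h ↦ h.1, ⟨⟨hZ, hle⟩, ?_⟩⟩,
    ⟨Z₀, rfl, pL, hpL, ?_⟩, fun α hα h ↦ ⟨hα, h⟩⟩
  -- Maximality descends to `L`: the closure of the image of `W` is irreducible and contains `Z₀`,
  -- so `hmax` applies to it inside the stratum.
  · rintro W ⟨hW, hWle⟩ hZW
    let T : Set Y := i ⁻¹' closure (geometricProj L f '' W)
    have hsub : closure (geometricProj L f '' W) ⊆ Set.range i := by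
      refine closure_minimal ?_ i.isClosedEmbedding.isClosed_range
      rintro _ ⟨x, hx, rfl⟩
      rw [hi, range_stratumι, hA]
      exact hWle hx
    have hT : i '' T = closure (geometricProj L f '' W) := Set.image_preimage_eq_of_subset hsub
    have hTirr : IsIrreducible T := by
      obtain ⟨t, ht⟩ := QuasiSober.sober
        (hW.image _ (geometricProj L f).continuous.continuousOn).closure isClosed_closure
      obtain ⟨t', rfl⟩ := hsub ht.mem
      have : T = closure {t'} := by
        rw [i.isClosedEmbedding.isInducing.closure_eq_preimage_closure_image, Set.image_singleton,
          ht.def]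
      rw [this]
      exact isIrreducible_singleton.closure
    have hjT : Set.range j ⊆ T := by
      rintro _ ⟨c, rfl⟩
      obtain ⟨w, hw⟩ := (geometricProj L f).surjective (i (j c))
      refine subset_closure ⟨w, hZW ?_, hw⟩
      change geometricProj L f w ∈ (Z₀ : Set (baseChange L f))
      rw [hw]
      exact subset_closure ⟨c, rfl⟩
    have h := hmax T hTirr (isClosed_closure.preimage i.continuous) hjT
    intro x hx
    change geometricProj L f x ∈ (Z₀ : Set (baseChange L f))
    rw [hZ₀]
    refine Set.image_mono h ?_
    rw [hT]
    exact subset_closure ⟨x, hx, rfl⟩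
  · rw [hZ₀, ← hp, Scheme.Hom.comp_base, TopCat.coe_comp, Set.range_comp]
    exact Set.image_mono hpj

end Faces

/-! ### Properness, finiteness of the complex and maximal faces -/

section MaximalFaces

-- The homogeneous polynomials of degree zero are the constants, so projective space is proper over
-- `K` itself.
attribute [local instance] MvPolynomial.gradedAlgebra in
theorem IsProjective.isProper {K : Type u} [Field K] {X : Scheme.{u}} {f : X ⟶ Spec (.of K)}
    (hf : IsProjective f) : IsProper f := by
  obtain ⟨m, i, hi, rfl⟩ := hf
  have : IsScalarTower K (MvPolynomial.homogeneousSubmodule (Fin (m + 1)) K 0)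
      (MvPolynomial (Fin (m + 1)) K) :=
    ⟨fun a b c ↦ smul_mul_assoc a b.1 c⟩
  have : Algebra.FiniteType (MvPolynomial.homogeneousSubmodule (Fin (m + 1)) K 0)
      (MvPolynomial (Fin (m + 1)) K) :=
    Algebra.FiniteType.of_restrictScalars_finiteType K _ _
  have hbij : Function.Bijective
      (algebraMap K (MvPolynomial.homogeneousSubmodule (Fin (m + 1)) K 0)) := by
    refine ⟨fun a b h ↦ MvPolynomial.C_injective (Fin (m + 1)) K congr(($h).1), fun ⟨p, hp⟩ ↦ ?_⟩
    have hp' : p.IsHomogeneous 0 := hp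
    rw [← MvPolynomial.totalDegree_zero_iff_isHomogeneous] at hp'
    refine ⟨p.coeff 0, Subtype.ext ?_⟩
    exact (MvPolynomial.totalDegree_eq_zero_iff_eq_C.mp hp').symm
  have : IsIso (CommRingCat.ofHom
      (algebraMap K (MvPolynomial.homogeneousSubmodule (Fin (m + 1)) K 0))) :=
    (RingEquiv.ofBijective _ hbij).toCommRingCatIso.isIso_hom
  infer_instance

variable {K : Type u} [Field K]

theorem noetherianSpace_of_locallyOfFiniteType {X : Scheme.{u}} (f : X ⟶ Spec (.of K))
    [LocallyOfFiniteType f] [QuasiCompact f] : NoetherianSpace X := by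
  have : IsLocallyNoetherian X := LocallyOfFiniteType.isLocallyNoetherian f
  have : CompactSpace X := QuasiCompact.compactSpace_of_compactSpace f
  have : IsNoetherian X := {}
  infer_instance

instance finite_geometricFace (L : Type u) [Field L] [Algebra K L] {X : Scheme.{u}}
    (f : X ⟶ Spec (.of K)) [LocallyOfFiniteType f] [QuasiCompact f] (D : Closeds X) :
    Finite (GeometricFace L f D) := by
  have := noetherianSpace_of_locallyOfFiniteType f
  have : NoetherianSpace (geometricBaseChange L f) :=
    noetherianSpace_of_locallyOfFiniteType
      (baseChangeSnd (AlgebraicClosure L) (baseChangeSnd L f))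
  let S : Set (Set (Closeds X) × Closeds (geometricBaseChange L f)) :=
    ⋃ A ∈ 𝒫 (components D), Prod.mk A '' components
      (closedPreimage (geometricProj L f ≫ baseChangeFst L f) (sInf A))
  have hS : S.Finite := (finite_components D).finite_subsets.biUnion fun A _ ↦
    (finite_components _).image _
  have := hS.to_subtype
  refine Finite.of_injective (β := S) (fun F ↦ ⟨(F.A, F.Z), ?_⟩) fun F G h ↦ ?_
  · exact Set.mem_biUnion F.subset_components ⟨F.Z, F.mem_components, rfl⟩
  · have h' := Prod.ext_iff.mp (Subtype.ext_iff.mp h)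
    exact GeometricFace.ext h'.1 h'.2

/-- There are finitely many tuples of faces, so the one attached to the points lies below a maximal
one; passing to a larger face only enlarges `A`. -/
theorem exists_maximal_mem_archimedeanClemensComplex [NumberField K] {X : Scheme.{u}}
    (f : X ⟶ Spec (.of K)) [LocallyOfFiniteType f] [QuasiCompact f] (n : ℕ) (D : Closeds X)
    (hsnc : IsStrictNormalCrossings f n D)
    (P : (v : InfinitePlace K) → (Spec (.of v.Completion) ⟶ X))
    (hP : ∀ v, P v ≫ f = Spec.map (CommRingCat.ofHom (algebraMap K v.Completion))) :
    ∃ F : FaceTuple f D, Maximal (· ∈ archimedeanClemensComplex f D) F ∧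
      ∀ v, ∀ α ∈ components D, Set.range (P v) ⊆ α → α ∈ (F v).A := by
  have := noetherianSpace_of_locallyOfFiniteType f
  choose F hF hFA using fun v ↦
    exists_mem_analyticClemensComplex v.Completion f n D hsnc (P v) (hP v)
  obtain ⟨G, hFG, hG⟩ := (Set.toFinite (archimedeanClemensComplex f D)).exists_le_maximal
    (show F ∈ archimedeanClemensComplex f D from hF)
  exact ⟨G, hG, fun v α hα h ↦ (hFG v).1 (hFA v α hα h)⟩

end MaximalFaces

/-! ### Bounded germs along an ultrafilter -/

section Germs

open Filter Topology

variable {I : Type u} (𝒰 : Ultrafilter I) (L : Type u) [NormedField L]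

/-- The valuation ring of bounded germs in an ultrapower of a normed field. -/
def boundedGerms : ValuationSubring (Germ (𝒰 : Filter I) L) where
  carrier := {x | ∃ (g : I → L) (C : ℝ), (g : Germ (𝒰 : Filter I) L) = x ∧ ∀ᶠ i in 𝒰, ‖g i‖ ≤ C}
  zero_mem' := ⟨0, 0, rfl, by simp⟩
  one_mem' := ⟨1, 1, rfl, by simp⟩
  add_mem' := by
    rintro _ _ ⟨g, C, rfl, hg⟩ ⟨h, C', rfl, hh⟩
    refine ⟨g + h, C + C', rfl, ?_⟩
    filter_upwards [hg, hh] with i h1 h2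
    exact (norm_add_le _ _).trans (add_le_add h1 h2)
  mul_mem' := by
    rintro _ _ ⟨g, C, rfl, hg⟩ ⟨h, C', rfl, hh⟩
    refine ⟨g * h, C * C', rfl, ?_⟩
    filter_upwards [hg, hh] with i h1 h2
    rw [Pi.mul_apply, norm_mul]
    exact mul_le_mul h1 h2 (norm_nonneg _) ((norm_nonneg _).trans h1)
  neg_mem' := by
    rintro _ ⟨g, C, rfl, hg⟩
    refine ⟨-g, C, rfl, ?_⟩
    filter_upwards [hg] with i h1
    simpa using h1
  mem_or_inv_mem' x := by
    induction x using Germ.inductionOn with | _ g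
    rcases 𝒰.em (fun i ↦ ‖g i‖ ≤ 1) with h | h
    · exact .inl ⟨g, 1, rfl, h⟩
    · refine .inr ⟨g⁻¹, 1, rfl, ?_⟩
      filter_upwards [h] with i hi
      rw [Pi.inv_apply, norm_inv]
      exact inv_le_one_of_one_le₀ (not_le.mp hi).le

variable {𝒰 L}

theorem coe_mem_boundedGerms {g : I → L} :
    (g : Germ (𝒰 : Filter I) L) ∈ boundedGerms 𝒰 L ↔ ∃ C : ℝ, ∀ᶠ i in 𝒰, ‖g i‖ ≤ C := by
  refine ⟨fun ⟨h, C, hgh, hC⟩ ↦ ⟨C, ?_⟩, fun ⟨C, hC⟩ ↦ ⟨g, C, rfl, hC⟩⟩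
  filter_upwards [Germ.coe_eq.mp hgh, hC] with i h1 h2
  rwa [← h1]

variable [ProperSpace L]

theorem exists_tendsto_boundedGerms (x : boundedGerms 𝒰 L) : ∃ a : L, x.1.Tendsto (𝓝 a) := by
  obtain ⟨x, g, C, rfl, hg⟩ := x
  have h : (𝒰.map g : Filter L) ≤ 𝓟 (Metric.closedBall 0 C) := by
    rw [le_principal_iff, Ultrafilter.mem_coe, Ultrafilter.mem_map]
    filter_upwards [hg] with i hi
    simpa using hi
  obtain ⟨a, -, ha⟩ := (isCompact_closedBall (0 : L) C).ultrafilter_le_nhds _ h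
  exact ⟨a, ha⟩

variable (𝒰 L) in
/-- The limit of bounded germs along an ultrafilter. -/
def limBoundedGerms : boundedGerms 𝒰 L →+* L :=
  have h (x) := (exists_tendsto_boundedGerms (𝒰 := 𝒰) (L := L) x).choose_spec
  have huniq {x : boundedGerms 𝒰 L} {a b : L} (ha : x.1.Tendsto (𝓝 a)) (hb : x.1.Tendsto (𝓝 b)) :
      a = b := by
    obtain ⟨x, g, C, rfl, hg⟩ := x
    exact tendsto_nhds_unique (l := (𝒰 : Filter I)) ha hb
  { toFun := fun x ↦ (exists_tendsto_boundedGerms x).choose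
    map_one' := huniq (h _) (tendsto_const_nhds (x := (1 : L)))
    map_zero' := huniq (h _) (tendsto_const_nhds (x := (0 : L)))
    map_add' := fun x y ↦ by
      refine huniq (h _) ?_
      have h1 := h x
      have h2 := h y
      obtain ⟨x, g, C, rfl, hg⟩ := x
      obtain ⟨y, g', C', rfl, hg'⟩ := y
      exact Tendsto.add h1 h2
    map_mul' := fun x y ↦ by
      refine huniq (h _) ?_
      have h1 := h x
      have h2 := h y
      obtain ⟨x, g, C, rfl, hg⟩ := x
      obtain ⟨y, g', C', rfl, hg'⟩ := y
      exact Tendsto.mul h1 h2 }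

theorem tendsto_limBoundedGerms (x : boundedGerms 𝒰 L) : x.1.Tendsto (𝓝 (limBoundedGerms 𝒰 L x)) :=
  (exists_tendsto_boundedGerms x).choose_spec

theorem limBoundedGerms_eq {x : boundedGerms 𝒰 L} {a : L} (ha : x.1.Tendsto (𝓝 a)) :
    limBoundedGerms 𝒰 L x = a := by
  have h := tendsto_limBoundedGerms x
  obtain ⟨x, g, C, rfl, hg⟩ := x
  exact tendsto_nhds_unique (l := (𝒰 : Filter I)) h ha

/-- A germ with nonzero limit has bounded inverse. Hence the limit map sends the point of `Spec L`
to the closed point of the valuation ring. -/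
instance isLocalHom_limBoundedGerms : IsLocalHom (limBoundedGerms 𝒰 L) where
  map_nonunit x hx := by
    have h0 : limBoundedGerms 𝒰 L x ≠ 0 := hx.ne_zero
    have hx0 : x.1 ≠ 0 := fun h ↦ h0 (by
      rw [show x = 0 from Subtype.ext h, map_zero])
    have h1 := tendsto_limBoundedGerms x
    have hinv : x.1⁻¹ ∈ boundedGerms 𝒰 L := by
      obtain ⟨x, g, C, rfl, hg⟩ := x
      have h2 : Tendsto (fun i ↦ ‖(g i)⁻¹‖) 𝒰 _ := (Tendsto.inv₀ h1 h0).norm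
      refine ⟨g⁻¹, _, rfl, h2.eventually (Iic_mem_nhds (lt_add_one _))⟩
    exact IsUnit.of_mul_eq_one ⟨x.1⁻¹, hinv⟩ (Subtype.ext (mul_inv_cancel₀ hx0))

end Germs

/-! ### Evaluation of functions and limits of rational points -/

section Evaluation

/-- The pull-back of functions along a morphism from an affine scheme. -/
def evalAt {X : Scheme.{u}} {S : CommRingCat.{u}} (m : Spec S ⟶ X) (W : X.Opens)
    (h : ⊤ ≤ m ⁻¹ᵁ W) : Γ(X, W) ⟶ S :=
  m.appLE W ⊤ h ≫ (Scheme.ΓSpecIso S).hom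

theorem evalAt_comp {X : Scheme.{u}} {S T : CommRingCat.{u}} (ψ : S ⟶ T) (m : Spec S ⟶ X)
    (W : X.Opens) (h : ⊤ ≤ m ⁻¹ᵁ W) :
    evalAt (Spec.map ψ ≫ m) W ((le_of_eq rfl).trans (Scheme.Hom.preimage_mono (Spec.map ψ) h)) =
      evalAt m W h ≫ ψ := by
  rw [evalAt, evalAt, Category.assoc, ← Scheme.ΓSpecIso_naturality,
    ← Scheme.Hom.appLE_comp_appLE _ _ W ⊤ ⊤ h le_rfl, Category.assoc, Scheme.Hom.appTop,
    Scheme.Hom.app_eq_appLE]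
  rfl

theorem evalAt_res {X : Scheme.{u}} {S : CommRingCat.{u}} (m : Spec S ⟶ X) {V W : X.Opens}
    (hVW : V ≤ W) (h : ⊤ ≤ m ⁻¹ᵁ V) :
    X.presheaf.map (homOfLE hVW).op ≫ evalAt m V h =
      evalAt m W (h.trans (Scheme.Hom.preimage_mono m hVW)) := by
  rw [evalAt, evalAt, ← Category.assoc, Scheme.Hom.map_appLE]

theorem evalAt_comp_hom {X Y : Scheme.{u}} {S : CommRingCat.{u}} (m : Spec S ⟶ X) (j : X ⟶ Y)
    (W : Y.Opens) (V : X.Opens) (hj : V ≤ j ⁻¹ᵁ W) (h : ⊤ ≤ m ⁻¹ᵁ V) :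
    evalAt (m ≫ j) W (h.trans (Scheme.Hom.preimage_mono m hj)) = j.appLE W V hj ≫ evalAt m V h := by
  rw [evalAt, evalAt, ← Category.assoc, Scheme.Hom.appLE_comp_appLE]

theorem spec_map_evalAt {X : Scheme.{u}} {S : CommRingCat.{u}} (m : Spec S ⟶ X) {V : X.Opens}
    (hV : IsAffineOpen V) (h : ⊤ ≤ m ⁻¹ᵁ V) : Spec.map (evalAt m V h) ≫ hV.fromSpec = m := by
  rw [evalAt, Spec.map_comp, Category.assoc, hV.SpecMap_appLE_fromSpec _ (isAffineOpen_top _),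
    IsAffineOpen.fromSpec_top,
    ← Category.assoc]
  simp [Scheme.isoSpec_Spec_inv]

theorem evalAt_congr {X : Scheme.{u}} {S : CommRingCat.{u}} {m m' : Spec S ⟶ X} (hm : m = m')
    (W : X.Opens) (h : ⊤ ≤ m ⁻¹ᵁ W) : evalAt m W h = evalAt m' W (hm ▸ h) := by
  subst hm; rfl

theorem evalAt_fromSpec {X : Scheme.{u}} {V : X.Opens} (hV : IsAffineOpen V) :
    evalAt hV.fromSpec V hV.fromSpec_preimage_self.ge = 𝟙 _ := by
  apply Spec.map_injective
  rw [← cancel_mono hV.fromSpec, spec_map_evalAt, Spec.map_id, Category.id_comp]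

/-- A family of rational points of a proper scheme has a limit along every ultrafilter, and
functions that are regular at the limit point are bounded. -/
theorem exists_limit_point {K : Type u} [Field K] {X : Scheme.{u}} (f : X ⟶ Spec (.of K))
    [IsProper f] {V : X.Opens} (hV : IsAffineOpen V) {I : Type u} (𝒰 : Ultrafilter I)
    (x : I → (Spec (.of K) ⟶ X)) (hxV : ∀ i, ⊤ ≤ x i ⁻¹ᵁ V) (hx : ∀ i, x i ≫ f = 𝟙 _)
    (L : Type u) [NormedField L] [ProperSpace L] [Algebra K L] :
    ∃ P : Spec (.of L) ⟶ X, P ≫ f = Spec.map (CommRingCat.ofHom (algebraMap K L)) ∧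
      ∀ (W : X.Opens) (hVW : V ≤ W), Set.range P ⊆ W → ∀ g : Γ(X, W), ∃ C : ℝ, ∀ᶠ i in 𝒰,
        ‖algebraMap K L (evalAt (x i) V (hxV i) (X.presheaf.map (homOfLE hVW).op g))‖ ≤ C := by
  let G := Filter.Germ (𝒰 : Filter I) L
  let B := boundedGerms 𝒰 L
  let φ (i : I) : Γ(X, V) ⟶ .of K := evalAt (x i) V (hxV i)
  let Φ₀ : Γ(X, V) →+* G := (Filter.Germ.coeRingHom _).comp
    (RingHom.pi fun i ↦ (algebraMap K L).comp (φ i).hom)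
  let Φ : Γ(X, V) ⟶ .of G := CommRingCat.ofHom Φ₀
  have hΦ (g : Γ(X, V)) : Φ g = ((fun i ↦ algebraMap K L (φ i g) : I → L) : G) := rfl
  let κ₀ : K →+* G := (Filter.Germ.coeRingHom _).comp (RingHom.pi fun i ↦ algebraMap K L)
  let κ : K →+* B := κ₀.codRestrict B.toSubring fun r ↦
    coe_mem_boundedGerms.mpr ⟨‖algebraMap K L r‖, .of_forall fun _ ↦ le_rfl⟩
  obtain ⟨χ, hχ⟩ := Spec.map_surjective (hV.fromSpec ≫ f)
  have hφχ (i : I) : χ ≫ φ i = 𝟙 _ := by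
    apply Spec.map_injective
    rw [Spec.map_comp, hχ, ← Category.assoc, spec_map_evalAt, hx, Spec.map_id]
  -- The family is a point of `V` over the field of germs. Constants are bounded, so the valuative
  -- criterion extends it to the ring of bounded germs.
  have hcomm : CommSq (Spec.map Φ ≫ hV.fromSpec)
      (Spec.map (CommRingCat.ofHom (algebraMap B G))) f (Spec.map (CommRingCat.ofHom κ)) := by
    constructor
    rw [Category.assoc, ← hχ, ← Spec.map_comp, ← Spec.map_comp]
    congr 1
    ext r
    change Φ (χ r) = κ₀ r
    rw [hΦ]
    change _ = ((fun i ↦ algebraMap K L r : I → L) : G)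
    congr 2
    ext i
    exact congr(algebraMap K L ($(hφχ i) r))
  obtain ⟨l, hl₁, hl₂⟩ : ∃ l : Spec (.of B) ⟶ X,
      Spec.map (CommRingCat.ofHom (algebraMap B G)) ≫ l = Spec.map Φ ≫ hV.fromSpec ∧
        l ≫ f = Spec.map (CommRingCat.ofHom κ) := by
    have hf : ValuativeCriterion.Existence f := by
      have := (inferInstance : UniversallyClosed f)
      rw [UniversallyClosed.eq_valuativeCriterion] at this
      exact this.1
    obtain ⟨⟨l, hl₁, hl₂⟩⟩ := (hf ⟨B, G, _, _, hcomm⟩).exists_lift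
    exact ⟨l, hl₁, hl₂⟩
  refine ⟨Spec.map (CommRingCat.ofHom (limBoundedGerms 𝒰 L)) ≫ l, ?_, ?_⟩
  · rw [Category.assoc, hl₂, ← Spec.map_comp]
    congr 1
    ext r
    exact limBoundedGerms_eq tendsto_const_nhds
  · intro W hVW hW g
    -- An open subset containing the closed point of a local scheme is everything, so `g` takes its
    -- value in `B`, which means that it is bounded.
    have hl : l ⁻¹ᵁ W = ⊤ := by
      refine (IsLocalRing.closed_point_mem_iff (R := B)).mp ?_
      rw [← IsLocalRing.comap_closedPoint (limBoundedGerms 𝒰 L)]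
      exact hW ⟨IsLocalRing.closedPoint L, rfl⟩
    let b : B := evalAt l W hl.ge g
    have hb : b.1 = Φ (X.presheaf.map (homOfLE hVW).op g) := by
      have h1 := evalAt_comp (CommRingCat.ofHom (algebraMap B G)) l W hl.ge
      have h2 := evalAt_comp Φ hV.fromSpec V hV.fromSpec_preimage_self.ge
      rw [evalAt_fromSpec, Category.id_comp] at h2
      rw [evalAt_congr hl₁, ← evalAt_res _ hVW (by
        rw [Scheme.Hom.comp_preimage, hV.fromSpec_preimage_self]; exact le_rfl), h2] at h1
      exact congr($h1.symm g)
    have hb' := b.2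
    rw [hb, hΦ] at hb'
    exact coe_mem_boundedGerms.mp hb'

end Evaluation

/-! ### Bounded denominators at integral points -/

section Integrality

open TensorProduct in
theorem exists_smul_eq_tmul_one {O K C : Type*} [CommRing O] [IsDomain O] [Field K] [Algebra O K]
    [IsFractionRing O K] [CommRing C] [Algebra O C] (z : C ⊗[O] K) :
    ∃ (N : O) (c : C), N ≠ 0 ∧ N • z = c ⊗ₜ 1 := by
  induction z with
  | zero => exact ⟨1, 0, one_ne_zero, by simp⟩
  | tmul c k =>
    obtain ⟨a, b, hb, rfl⟩ := IsFractionRing.div_surjective (A := O) k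
    have hb0 : algebraMap O K b ≠ 0 :=
      IsFractionRing.to_map_ne_zero_of_mem_nonZeroDivisors hb
    refine ⟨b, a • c, nonZeroDivisors.ne_zero hb, ?_⟩
    rw [smul_tmul', smul_tmul, Algebra.smul_def, mul_div_cancel₀ _ hb0, smul_tmul,
      Algebra.smul_def, mul_one]
  | add x y hx hy =>
    obtain ⟨N, c, hN, hx⟩ := hx
    obtain ⟨N', c', hN', hy⟩ := hy
    refine ⟨N * N', N' • c + N • c', mul_ne_zero hN hN', ?_⟩
    rw [smul_add, mul_smul, mul_smul, smul_comm, hx, hy, add_tmul, smul_tmul', smul_tmul']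

/-- The denominators of `κ` form an ideal, which by assumption lies in no maximal ideal. -/
theorem mem_range_algebraMap_of_forall_isMaximal {O K : Type*} [CommRing O] [Field K]
    [Algebra O K] (κ : K)
    (h : ∀ q : Ideal O, q.IsMaximal → ∃ d ∉ q, algebraMap O K d * κ ∈ (algebraMap O K).range) :
    κ ∈ (algebraMap O K).range := by
  let J : Ideal O :=
    { carrier := {d | algebraMap O K d * κ ∈ (algebraMap O K).range}
      add_mem' := fun {a b} ha hb ↦ by
        simp only [Set.mem_ofPred_eq, map_add, add_mul] at ha hb ⊢
        exact add_mem ha hb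
      zero_mem' := ⟨0, by simp⟩
      smul_mem' := fun a b hb ↦ by
        simp only [Set.mem_ofPred_eq, smul_eq_mul, map_mul, mul_assoc] at hb ⊢
        exact mul_mem ⟨a, rfl⟩ hb }
  have hJ : J = ⊤ := by
    by_contra hJ
    obtain ⟨q, hq, hJq⟩ := Ideal.exists_le_maximal J hJ
    obtain ⟨d, hd, h1⟩ := h q hq
    exact hd (hJq h1)
  have : (1 : O) ∈ J := hJ ▸ Submodule.mem_top
  simpa [J] using this

variable {K : Type u} [Field K] {U : Scheme.{u}} {g : U ⟶ Spec (.of K)}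
  (𝔘 : IntegralModel g)

theorem IntegralModel.IntegralPoint.toRational_comp_fromGeneric {𝔘 : IntegralModel g}
    (s : 𝔘.IntegralPoint) : s.toRational ≫ 𝔘.fromGeneric =
      Spec.map (CommRingCat.ofHom (algebraMap (𝓞 K) K)) ≫ s.1 :=
  𝔘.isPullback.lift_fst _ _ _

theorem IntegralModel.IntegralPoint.toRational_comp {𝔘 : IntegralModel g}
    (s : 𝔘.IntegralPoint) : s.toRational ≫ g = 𝟙 _ :=
  𝔘.isPullback.lift_snd _ _ _

-- The generic fibre of `W` is the spectrum of `C ⊗ K`, on which `N h` comes from some `c` in `C`,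
-- with `N` independent of the point. Near `q` the section lands in `W`, so `c` takes a value in a
-- localization `𝓞 K[1/d]` with `d ∉ q`.
open TensorProduct in
theorem IntegralModel.exists_integral_of_affine [NumberField K] {W : 𝔘.scheme.Opens}
    (hW : IsAffineOpen W) (h : Γ(U, ⊤)) : ∃ N : 𝓞 K, N ≠ 0 ∧
      ∀ (s : 𝔘.IntegralPoint) (q : Spec (.of (𝓞 K))),
      s.1 q ∈ W → ∃ d ∉ q.asIdeal, algebraMap (𝓞 K) K d *
        (algebraMap (𝓞 K) K N * evalAt s.toRational ⊤ le_top h) ∈ (algebraMap (𝓞 K) K).range := by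
  let C := Γ(𝔘.scheme, W)
  obtain ⟨χ, hχ⟩ := Spec.map_surjective (hW.fromSpec ≫ 𝔘.toBase)
  let _ : Algebra (𝓞 K) C := χ.hom.toAlgebra
  have hχ' : χ = CommRingCat.ofHom (algebraMap (𝓞 K) C) := rfl
  let iC : C ⟶ .of (C ⊗[𝓞 K] K) := CommRingCat.ofHom Algebra.TensorProduct.includeLeftRingHom
  let iK : CommRingCat.of K ⟶ .of (C ⊗[𝓞 K] K) :=
    CommRingCat.ofHom (Algebra.TensorProduct.includeRight (R := 𝓞 K)).toRingHom
  let u : Spec (.of (C ⊗[𝓞 K] K)) ⟶ U := 𝔘.isPullback.lift (Spec.map iC ≫ hW.fromSpec)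
    (Spec.map iK) (by
      rw [Category.assoc, ← hχ, ← Spec.map_comp, ← Spec.map_comp]
      congr 1
      ext r
      change algebraMap (𝓞 K) C r ⊗ₜ[𝓞 K] (1 : K) = (1 : C) ⊗ₜ[𝓞 K] algebraMap (𝓞 K) K r
      rw [Algebra.algebraMap_eq_smul_one, smul_tmul, Algebra.algebraMap_eq_smul_one])
  obtain ⟨N, c, hN, hz⟩ := exists_smul_eq_tmul_one (O := 𝓞 K) (K := K) (evalAt u ⊤ le_top h)
  refine ⟨N, hN, fun s q hq ↦ ?_⟩
  obtain ⟨_, ⟨d, rfl⟩, hqd, hdW⟩ :=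
    PrimeSpectrum.isTopologicalBasis_basic_opens.exists_subset_of_mem_open
      (show q ∈ (s.1 ⁻¹ᵁ W : Set (Spec (.of (𝓞 K)))) from hq) (s.1 ⁻¹ᵁ W).isOpen
  let A := Localization.Away d
  have hd0 : d ≠ 0 := fun h ↦ hqd (h ▸ zero_mem _)
  let ρ : A →+* K := IsLocalization.Away.lift d
    (g := algebraMap (𝓞 K) K) (isUnit_iff_ne_zero.mpr (by simpa using hd0))
  have hρ (a : 𝓞 K) : ρ (algebraMap _ A a) = algebraMap _ K a := IsLocalization.Away.lift_eq ..
  let m : Spec (.of A) ⟶ 𝔘.scheme := Spec.map (CommRingCat.ofHom (algebraMap (𝓞 K) A)) ≫ s.1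
  have hm : ⊤ ≤ m ⁻¹ᵁ W := by
    intro y _
    refine hdW ?_
    have : Set.range (PrimeSpectrum.comap (algebraMap (𝓞 K) A)) = PrimeSpectrum.basicOpen d :=
      PrimeSpectrum.localization_away_comap_range A d
    exact this.le ⟨y, rfl⟩
  let σ : C ⟶ .of A := evalAt m W hm
  have hσ : χ ≫ σ = CommRingCat.ofHom (algebraMap (𝓞 K) A) := by
    apply Spec.map_injective
    rw [Spec.map_comp, hχ, ← Category.assoc, spec_map_evalAt, Category.assoc, s.2,
      Category.comp_id]
  let ρσ : C →ₐ[𝓞 K] K :=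
    { ρ.comp σ.hom with
      commutes' := fun r ↦ (congr_arg ρ congr($hσ r)).trans (hρ r) }
  let τ : C ⊗[𝓞 K] K →ₐ[𝓞 K] K := Algebra.TensorProduct.lift ρσ (AlgHom.id _ _) fun _ _ ↦ .all _ _
  have hτC : iC ≫ CommRingCat.ofHom τ.toRingHom = σ ≫ CommRingCat.ofHom ρ := by
    ext r
    change τ (r ⊗ₜ 1) = ρ (σ r)
    simp [τ, ρσ]
  have hτK : iK ≫ CommRingCat.ofHom τ.toRingHom = 𝟙 _ := by
    ext r
    change τ (1 ⊗ₜ r) = r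
    simp [τ]
  have hy : Spec.map (CommRingCat.ofHom τ.toRingHom) ≫ u = s.toRational := by
    apply 𝔘.isPullback.hom_ext
    · rw [Category.assoc, 𝔘.isPullback.lift_fst, ← Category.assoc, ← Spec.map_comp, hτC,
        s.toRational_comp_fromGeneric, Spec.map_comp, Category.assoc, spec_map_evalAt,
        ← Category.assoc, ← Spec.map_comp]
      congr 2
      ext r
      exact hρ r
    · rw [Category.assoc, 𝔘.isPullback.lift_snd, ← Spec.map_comp, hτK, s.toRational_comp,
        Spec.map_id]
  have hval : evalAt s.toRational ⊤ le_top h = τ (evalAt u ⊤ le_top h) := by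
    rw [← evalAt_congr hy _ le_top]
    exact congr($(evalAt_comp (CommRingCat.ofHom τ.toRingHom) u ⊤ le_top) h)
  have hmain : algebraMap (𝓞 K) K N * evalAt s.toRational ⊤ le_top h = ρ (σ c) := by
    rw [hval, ← Algebra.smul_def, ← map_smul, hz]
    exact congr($hτC c)
  rw [hmain]
  obtain ⟨⟨a, ⟨_, k, rfl⟩⟩, hb⟩ := IsLocalization.surj (Submonoid.powers d) (σ c)
  refine ⟨d ^ k, fun h ↦ hqd (q.isPrime.mem_of_pow_mem k h), a, ?_⟩
  rw [← hρ, ← hb, map_mul, mul_comm]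
  simp [hρ]

/-- After multiplication by a nonzero integer, a regular function on the generic fibre of an
integral model takes integral values at integral points. -/
theorem IntegralModel.exists_integral [NumberField K] (h : Γ(U, ⊤)) : ∃ N : 𝓞 K, N ≠ 0 ∧
    ∀ s : 𝔘.IntegralPoint, algebraMap (𝓞 K) K N * evalAt s.toRational ⊤ le_top h ∈
      (algebraMap (𝓞 K) K).range := by
  have := 𝔘.quasiCompact
  have : CompactSpace 𝔘.scheme := QuasiCompact.compactSpace_of_compactSpace 𝔘.toBase
  let S := 𝔘.scheme.affineCover.finiteSubcover
  choose N hN0 hN using fun i : S.I₀ ↦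
    𝔘.exists_integral_of_affine (isAffineOpen_opensRange (S.f i)) h
  have : Fintype S.I₀ := Fintype.ofFinite _
  -- One factor for each member of a finite affine cover: every prime is mapped into some member,
  -- whose factor divides the product.
  refine ⟨∏ i, N i, Finset.prod_ne_zero_iff.mpr fun i _ ↦ hN0 i, fun s ↦ ?_⟩
  refine mem_range_algebraMap_of_forall_isMaximal _ fun q hq ↦ ?_
  obtain ⟨i, hi⟩ : ∃ i, s.1 (⟨q, hq.isPrime⟩ : PrimeSpectrum (𝓞 K)) ∈ (S.f i).opensRange :=
    ⟨_, S.covers _⟩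
  obtain ⟨d, hd, r, hr⟩ := hN i s _ hi
  obtain ⟨t, ht⟩ := Finset.dvd_prod_of_mem N (Finset.mem_univ i)
  refine ⟨d, hd, t * r, ?_⟩
  rw [ht, map_mul, map_mul, hr]
  ring

end Integrality

/-! ### Relative dimension and nonemptiness of the complement -/

section Dimension

/-- Expresses the relative dimension through the function field, where it no longer depends on a
chart. -/
theorem rank_kaehlerDifferential_of_isFractionRing {k R F : Type*} [CommRing k] [CommRing R]
    [IsDomain R] [Field F] [Algebra k R] [Algebra R F] [Algebra k F] [IsScalarTower k R F]
    [IsFractionRing R F] (n : ℕ) [Algebra.IsStandardSmoothOfRelativeDimension n k R] :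
    Module.rank F Ω[F⁄k] = n := by
  have : Algebra.FormallyEtale R F := .of_isLocalization (nonZeroDivisors R)
  have : Algebra.IsStandardSmooth k R :=
    Algebra.IsStandardSmoothOfRelativeDimension.isStandardSmooth n
  have h := (KaehlerDifferential.tensorKaehlerEquivOfFormallyEtale k R F).lift_rank_eq
  have h2 := Algebra.IsStandardSmoothOfRelativeDimension.rank_kaehlerDifferential (R := k) (S := R) n
  have h3 := Module.rank_baseChange (R := F) (S := R) (M' := Ω[R⁄k])
  rw [h2] at h3
  simp only [Cardinal.lift_natCast] at h3
  rw [h3] at h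
  simpa using h.symm

variable {K : Type u} [Field K] {X : Scheme.{u}}

theorem rank_kaehlerDifferential_functionField [IsIntegral X] (f : X ⟶ Spec (.of K)) (n : ℕ)
    [hf : SmoothOfRelativeDimension n f] :
    letI := (f.appTop ≫ X.presheaf.germ ⊤ (genericPoint X) trivial).hom.toAlgebra
    Module.rank X.functionField Ω[X.functionField⁄Γ(Spec (.of K), ⊤)] = n := by
  obtain ⟨U, hU, V, hV, hx, e, h⟩ :=
    hf.exists_isStandardSmoothOfRelativeDimension (Classical.arbitrary X)
  have : Nonempty V := ⟨⟨_, hx⟩⟩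
  obtain rfl : U = ⊤ := by
    refine eq_top_iff.mpr fun y _ ↦ ?_
    have : Subsingleton (Spec (.of K)) := inferInstanceAs (Subsingleton (PrimeSpectrum K))
    rw [Subsingleton.elim y (f (Classical.arbitrary X))]
    exact e hx
  let := (f.appTop ≫ X.presheaf.germ ⊤ (genericPoint X) trivial).hom.toAlgebra
  let := (f.appLE ⊤ V e).hom.toAlgebra
  have : Algebra.IsStandardSmoothOfRelativeDimension n Γ(Spec (.of K), ⊤) Γ(X, V) := h
  have : IsFractionRing Γ(X, V) X.functionField :=
    functionField_isFractionRing_of_isAffineOpen X V hV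
  have : IsScalarTower Γ(Spec (.of K), ⊤) Γ(X, V) X.functionField := by
    refine .of_algebraMap_eq' ?_
    change (f.appTop ≫ X.presheaf.germ ⊤ (genericPoint X) trivial).hom =
      (f.appLE ⊤ V e ≫ X.germToFunctionField V).hom
    congr 1
    rw [Scheme.Hom.appLE, Category.assoc]
    congr 1
    exact (X.presheaf.germ_res _ _ _).symm
  exact rank_kaehlerDifferential_of_isFractionRing (R := Γ(X, V)) n

/-- The relative dimension of an integral smooth scheme over a field is well defined. -/
theorem eq_of_smoothOfRelativeDimension [IsIntegral X] (f : X ⟶ Spec (.of K)) {m n : ℕ}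
    (hm : SmoothOfRelativeDimension m f) (hn : SmoothOfRelativeDimension n f) : m = n := by
  have h1 := rank_kaehlerDifferential_functionField f m
  have h2 := rank_kaehlerDifferential_functionField f n
  exact_mod_cast h1.symm.trans h2

/-- A strict normal crossings divisor is not the whole variety. -/
theorem IsStrictNormalCrossings.ne_top [IsIntegral X] {f : X ⟶ Spec (.of K)} {n : ℕ}
    [hf : SmoothOfRelativeDimension n f] {D : Closeds X} (hD : IsStrictNormalCrossings f n D) :
    D ≠ ⊤ := by
  rintro rfl
  have htop : (⊤ : Closeds X) ∈ components (⊤ : Closeds X) :=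
    ⟨⟨IrreducibleSpace.isIrreducible_univ X, le_rfl⟩, fun _ _ _ ↦ le_top⟩
  have hbot : stratumIdeal {(⊤ : Closeds X)} = ⊥ := by
    simp only [stratumIdeal, Finset.mem_singleton, iSup_iSup_eq_left]
    rw [Scheme.IdealSheafData.vanishingIdeal_top, Scheme.nilradical_eq_bot]
  have hiso : IsIso (stratumι {(⊤ : Closeds X)}) :=
    (Scheme.isIso_subschemeι_iff_eq_bot _).mpr hbot
  obtain ⟨d, hd, hs⟩ := hD {⊤} (by simpa using htop)
    ⟨inv (stratumι {(⊤ : Closeds X)}) (Classical.arbitrary X)⟩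
  -- The stratum of the single component `⊤` is `X` itself, an isomorphism having relative dimension
  -- `0`; so `X` would have dimension both `n` and `d` with `d + 1 = n`.
  have h2 : SmoothOfRelativeDimension (0 + d)
      (inv (stratumι {(⊤ : Closeds X)}) ≫ stratumι {(⊤ : Closeds X)} ≫ f) := inferInstance
  rw [IsIso.inv_hom_id_assoc, zero_add] at h2
  have := eq_of_smoothOfRelativeDimension f h2 hf
  simp at hd
  omega

end Dimension

/-! ### Finiteness of bounded integers, and generic ultrafilters -/

section Obstruction

variable {K : Type u} [Field K]

instance (v : InfinitePlace K) : ProperSpace v.Completion where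
  isCompact_closedBall x r := by
    have h := InfinitePlace.Completion.isometry_extensionEmbedding v
    rw [← h.preimage_closedBall]
    exact h.isClosedEmbedding.isCompact_preimage (isCompact_closedBall _ _)

/-- Algebraic integers that are bounded at all archimedean places are eventually constant along
an ultrafilter. -/
theorem exists_eventually_eq [NumberField K] {I : Type*} (𝒰 : Ultrafilter I) (y : I → K)
    (hint : ∀ i, y i ∈ (algebraMap (𝓞 K) K).range)
    (hb : ∀ v : InfinitePlace K, ∃ C : ℝ, ∀ᶠ i in 𝒰, v (y i) ≤ C) :
    ∃ c, ∀ᶠ i in 𝒰, y i = c := by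
  choose C hC using hb
  obtain ⟨B, hB⟩ := (Set.finite_range C).bddAbove
  -- Only finitely many algebraic integers of `K` have all conjugates bounded by `B`; an ultrafilter
  -- selects one of finitely many values.
  have hfin := NumberField.Embeddings.finite_of_norm_le K ℂ B
  have hmem : ∀ᶠ i in 𝒰, y i ∈ {x : K | IsIntegral ℤ x ∧ ∀ φ : K →+* ℂ, ‖φ x‖ ≤ B} := by
    filter_upwards [Filter.eventually_all.mpr hC] with i hi
    obtain ⟨a, ha⟩ := hint i
    exact ⟨ha ▸ RingOfIntegers.isIntegral_coe a,
      fun φ ↦ (hi (InfinitePlace.mk φ)).trans (hB ⟨_, rfl⟩)⟩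
  obtain ⟨c, -, hc⟩ := (Ultrafilter.finite_biUnion_mem_iff (f := 𝒰) (s := fun c ↦ {i | y i = c})
    hfin).mp (by filter_upwards [hmem] with i hi; simpa using hi)
  exact ⟨c, hc⟩

theorem evalAt_ne_zero {X : Scheme.{u}} {S : CommRingCat.{u}} [Nontrivial S] (m : Spec S ⟶ X)
    {V : X.Opens} (h : ⊤ ≤ m ⁻¹ᵁ V) (g : Γ(X, V)) (hg : ⊤ ≤ m ⁻¹ᵁ X.basicOpen g) :
    evalAt m V h g ≠ 0 := by
  have h1 := congr($(evalAt_res m (X.basicOpen_le g) hg) g)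
  rw [← h1]
  exact ((RingedSpace.isUnit_res_basicOpen _ g).map (evalAt m _ hg).hom).ne_zero

theorem top_le_preimage {F : Type u} [Field F] {X : Scheme.{u}} (m : Spec (.of F) ⟶ X)
    {W : X.Opens} {x : X} (hx : x ∈ Set.range m) (hxW : x ∈ W) : ⊤ ≤ m ⁻¹ᵁ W := by
  obtain ⟨y, rfl⟩ := hx
  intro z _
  have : Subsingleton (Spec (.of F)) := inferInstanceAs (Subsingleton (PrimeSpectrum F))
  rwa [Subsingleton.elim z y]

/-- A family of rational points that meets every nonempty open subset of `V` admits an ultrafilter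
along which a regular function on `V` vanishes only if it is zero. -/
theorem exists_ultrafilter_evalAt {X : Scheme.{u}} [IsIntegral X] {V : X.Opens} [Nonempty V]
    {I : Type*} (x : I → (Spec (.of K) ⟶ X)) (hxV : ∀ i, ⊤ ≤ x i ⁻¹ᵁ V)
    (hx : ∀ W : X.Opens, W ≤ V → (W : Set X).Nonempty → ∃ i, ⊤ ≤ x i ⁻¹ᵁ W) :
    ∃ 𝒰 : Ultrafilter I, ∀ g : Γ(X, V), (∀ᶠ i in 𝒰, evalAt (x i) V (hxV i) g = 0) → g = 0 := by
  let S (g : {g : Γ(X, V) // g ≠ 0}) : Set I := {i | evalAt (x i) V (hxV i) g.1 ≠ 0}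
  have hne (g) : (S g).Nonempty := by
    have hB : (X.basicOpen g.1 : Set X).Nonempty := by
      by_contra hB
      exact g.2 (eq_zero_of_basicOpen_eq_bot g.1 (Opens.not_nonempty_iff_eq_bot _ |>.mp hB))
    obtain ⟨i, hi⟩ := hx _ (X.basicOpen_le g.1) hB
    exact ⟨i, evalAt_ne_zero _ _ _ hi⟩
  have : Nonempty {g : Γ(X, V) // g ≠ 0} := ⟨⟨1, one_ne_zero⟩⟩
  have : Nonempty I := (hne (Classical.arbitrary _)).nonempty
  -- The nonvanishing locus of a product lies in both nonvanishing loci, and the product is nonzero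
  -- because `X` is integral.
  have hdir : Directed (· ≥ ·) fun g ↦ Filter.principal (S g) := by
    refine fun a b ↦ ⟨⟨a.1 * b.1, mul_ne_zero a.2 b.2⟩, ?_, ?_⟩ <;>
    · refine Filter.principal_mono.mpr fun i hi ↦ ?_
      simp only [S, Set.mem_ofPred_eq, map_mul] at hi ⊢
      first | exact left_ne_zero_of_mul hi | exact right_ne_zero_of_mul hi
  have := Filter.iInf_neBot_of_directed hdir fun g ↦ Filter.principal_neBot_iff.mpr (hne g)
  refine ⟨Ultrafilter.of (⨅ g, Filter.principal (S g)), fun g hg ↦ ?_⟩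
  by_contra hg0
  have h1 : S ⟨g, hg0⟩ ∈ Ultrafilter.of (⨅ g, Filter.principal (S g)) :=
    Ultrafilter.of_le _ (Filter.mem_iInf_of_mem _ (Filter.mem_principal_self _))
  obtain ⟨i, hi, hi'⟩ := Filter.nonempty_of_mem (Filter.inter_mem h1 hg)
  exact hi hi'

/-- A supremum of closed subsets is in general the closure of their union; finiteness of the set of
components makes it the union. -/
theorem mem_openOfFace {X : Scheme.{u}} [NoetherianSpace X] {f : X ⟶ Spec (.of K)} {D : Closeds X}
    (F : FaceTuple f D) (x : X)
    (hx : ∀ α ∈ components D, x ∈ α → ∃ v, α ∈ (F v).A) : x ∈ openOfFace F := by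
  intro hxF
  have hfin : {α | α ∈ components D ∧ ∀ v, α ∉ (F v).A}.Finite :=
    (finite_components D).subset fun α h ↦ h.1
  have hxF' : x ∈ hfin.toFinset.sup id := by
    rw [Finset.sup_id_eq_sSup, hfin.coe_toFinset]
    exact hxF
  rw [← SetLike.mem_coe, Closeds.coe_finset_sup] at hxF'
  simp only [Set.mem_iUnion, Function.comp_apply, id, Finset.sup_set_eq_biUnion,
    Set.Finite.mem_toFinset] at hxF'
  obtain ⟨α, ⟨hα, hα'⟩, hxα⟩ := hxF'
  obtain ⟨v, hv⟩ := hx α hα hxα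
  exact hα' v hv

theorem divisorCompl_le_openOfFace {X : Scheme.{u}} {f : X ⟶ Spec (.of K)} {D : Closeds X}
    (F : FaceTuple f D) : divisorCompl D ≤ openOfFace F := by
  have h : complementDivisor F ≤ D := sSup_le fun α hα ↦ hα.1.1.2
  exact fun x hx hxF ↦ hx (h hxF)

end Obstruction

/-! ### Recognizing constant functions -/

section Constants

variable {K : Type u} [Field K]

theorem exists_forall_integral [NumberField K] {X : Scheme.{u}} {f : X ⟶ Spec (.of K)}
    {D : Closeds X} (𝔘 : IntegralModel ((divisorCompl D).ι ≫ f)) {V W : X.Opens} (hV : V ≤ divisorCompl D)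
    (hW : divisorCompl D ≤ W) (g : Γ(X, W)) : ∃ N : 𝓞 K, N ≠ 0 ∧
      ∀ (s : 𝔘.IntegralPoint) (h : ⊤ ≤ (s.toRational ≫ (divisorCompl D).ι) ⁻¹ᵁ V),
        algebraMap (𝓞 K) K N * evalAt (s.toRational ≫ (divisorCompl D).ι) V h
          (X.presheaf.map (homOfLE (hV.trans hW)).op g) ∈ (algebraMap (𝓞 K) K).range := by
  have hj : ⊤ ≤ (divisorCompl D).ι ⁻¹ᵁ W := fun x _ ↦ hW x.2
  obtain ⟨N, hN, hNs⟩ := 𝔘.exists_integral ((divisorCompl D).ι.appLE W ⊤ hj g)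
  refine ⟨N, hN, fun s h ↦ ?_⟩
  have h1 := congr($(evalAt_res (s.toRational ≫ (divisorCompl D).ι) (hV.trans hW) h) g)
  have h2 := congr($(evalAt_comp_hom s.toRational (divisorCompl D).ι W ⊤ hj le_top) g)
  convert hNs s using 2
  exact h1.trans h2

/-- Restriction to a nonempty open subset is injective on an integral scheme, so `g = c / N` may be
checked on `V`. -/
theorem mem_range_appLE_of_mul_eq {X : Scheme.{u}} [IsIntegral X] (f : X ⟶ Spec (.of K))
    {V W : X.Opens} [Nonempty V] (hVW : V ≤ W) (g : Γ(X, W)) (N c : K) (hN : N ≠ 0)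
    (h : (f.appLE ⊤ V le_top ((Scheme.ΓSpecIso (.of K)).inv N)) *
      X.presheaf.map (homOfLE hVW).op g = f.appLE ⊤ V le_top ((Scheme.ΓSpecIso (.of K)).inv c)) :
    g ∈ Set.range (f.appLE ⊤ W le_top) := by
  refine ⟨(Scheme.ΓSpecIso (.of K)).inv (N⁻¹ * c), ?_⟩
  apply map_injective_of_isIntegral X (homOfLE hVW)
  have h1 (t) : X.presheaf.map (homOfLE hVW).op (f.appLE ⊤ W le_top t) = f.appLE ⊤ V le_top t :=
    congr($(f.appLE_map (U := ⊤) le_top (homOfLE hVW).op) t)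
  rw [h1, map_mul, map_mul, ← h, ← mul_assoc, ← map_mul, ← map_mul, inv_mul_cancel₀ hN,
    map_one, map_one, one_mul]

theorem evalAt_const {X : Scheme.{u}} (f : X ⟶ Spec (.of K)) (x : Spec (.of K) ⟶ X)
    (hx : x ≫ f = 𝟙 _) {V : X.Opens} (h : ⊤ ≤ x ⁻¹ᵁ V) (c : K) :
    evalAt x V h (f.appLE ⊤ V le_top ((Scheme.ΓSpecIso (.of K)).inv c)) = c := by
  have h1 := congr($(evalAt_comp_hom x f ⊤ V le_top h) ((Scheme.ΓSpecIso (.of K)).inv c))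
  have h2 := congr($(evalAt_congr hx ⊤ le_top) ((Scheme.ΓSpecIso (.of K)).inv c))
  refine (h1.symm.trans h2).trans ?_
  have h3 : (Scheme.ΓSpecIso (.of K)).inv ≫ evalAt (𝟙 _) ⊤ le_top = 𝟙 _ := by
    simp [evalAt, Scheme.Hom.appLE]
  exact congr($h3 c)

end Constants

end ClemensObstruction

end

/-! ### The obstruction to density -/

theorem corollary2p9 {K : Type u} [Field K] [NumberField K]
    {X : Scheme.{u}} (f : X ⟶ Spec (.of K)) (n : ℕ)
    [SmoothOfRelativeDimension n f] [GeometricallyIntegral f] (hproj : IsProjective f)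
    (D : Closeds X) (hsnc : IsStrictNormalCrossings f n D)
    (hsplit : HasGeometricallyIrreducibleComponents f D)
    (hobs : ∀ F : FaceTuple f D, Maximal (· ∈ archimedeanClemensComplex f D) F →
      HasNonconstantFunction f (openOfFace F))
    (𝔘 : IntegralModel ((divisorCompl D).ι ≫ f)) :
    ¬ Dense 𝔘.integralLocus := by
  intro hdense
  have := hproj.isProper
  have : Subsingleton (Spec (.of K)) := inferInstanceAs (Subsingleton (PrimeSpectrum K))
  have : IsIntegral X := GeometricallyIntegral.isIntegral_of_subsingleton f
  have := noetherianSpace_of_locallyOfFiniteType f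
  obtain ⟨a, ha⟩ : ∃ a, a ∈ divisorCompl D := by
    by_contra! h
    exact hsnc.ne_top (eq_top_iff.mpr fun x _ ↦ not_not.mp (h x))
  obtain ⟨_, ⟨V, hV, rfl⟩, haV, hVD⟩ :=
    X.isBasis_affineOpens.exists_subset_of_mem_open ha (divisorCompl D).isOpen
  have hV : IsAffineOpen V := hV
  have hVD : V ≤ divisorCompl D := hVD
  have : Nonempty V := ⟨⟨a, haV⟩⟩
  let pt (s : 𝔘.IntegralPoint) : Spec (.of K) ⟶ X := s.toRational ≫ (divisorCompl D).ι
  have hpt (s) : pt s ≫ f = 𝟙 _ := by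
    rw [Category.assoc, s.toRational_comp]
  let I : Type u := {s // ⊤ ≤ pt s ⁻¹ᵁ V}
  let x (i : I) := pt i.1
  obtain ⟨𝒰, h𝒰⟩ := exists_ultrafilter_evalAt x (fun i ↦ i.2) (V := V) <| by
    rintro W hW ⟨b, hb⟩
    obtain ⟨y, hyW, s, hys⟩ := hdense.inter_open_nonempty _
      ((divisorCompl D).ι ⁻¹ᵁ W).isOpen ⟨⟨b, hVD (hW hb)⟩, hb⟩
    have hs : ⊤ ≤ pt s ⁻¹ᵁ W := top_le_preimage _ (x := (divisorCompl D).ι y)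
      (by obtain ⟨z, rfl⟩ := hys; exact ⟨z, rfl⟩) hyW
    exact ⟨⟨s, hs.trans (Scheme.Hom.preimage_mono _ hW)⟩, hs⟩
  choose P hPf hP using fun v : InfinitePlace K ↦
    exists_limit_point f hV 𝒰 x (fun i ↦ i.2) (fun i ↦ hpt i.1) v.Completion
  obtain ⟨F, hF, hFA⟩ := exists_maximal_mem_archimedeanClemensComplex f n D hsnc P hPf
  have hDF := divisorCompl_le_openOfFace F
  -- Every component of `D` through `P v` belongs to the face `F v`, so none of those removed in
  -- `openOfFace F` contains it.
  have hPF (v) : Set.range (P v) ⊆ openOfFace F := by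
    rintro _ ⟨z, rfl⟩
    refine mem_openOfFace F _ fun α hα hzα ↦ ⟨v, hFA v α hα ?_⟩
    have : Subsingleton (Spec (.of v.Completion)) :=
      inferInstanceAs (Subsingleton (PrimeSpectrum v.Completion))
    rintro _ ⟨z', rfl⟩
    rwa [Subsingleton.elim z' z]
  refine hobs F hF fun g ↦ ?_
  obtain ⟨N, hN, hNg⟩ := exists_forall_integral 𝔘 hVD hDF g
  have hN' : algebraMap (𝓞 K) K N ≠ 0 := by simpa using hN
  obtain ⟨c, hc⟩ := exists_eventually_eq 𝒰 (fun i ↦ algebraMap (𝓞 K) K N *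
    evalAt (x i) V i.2 (X.presheaf.map (homOfLE (hVD.trans hDF)).op g)) (fun i ↦ hNg i.1 i.2) <| by
    intro v
    obtain ⟨C, hC⟩ := hP v (openOfFace F) (hVD.trans hDF) (hPF v) g
    refine ⟨v (algebraMap (𝓞 K) K N) * C, ?_⟩
    filter_upwards [hC] with i hi
    rw [map_mul]
    refine mul_le_mul_of_nonneg_left ?_ (apply_nonneg v _)
    rwa [InfinitePlace.Completion.algebraMap_apply, InfinitePlace.Completion.norm_coe] at hi
  refine mem_range_appLE_of_mul_eq f (hVD.trans hDF) g _ c hN' ?_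
  rw [← sub_eq_zero]
  -- By the choice of the ultrafilter, `N g - c` is zero on `V` once it vanishes at the points along
  -- `𝒰`.
  apply h𝒰
  filter_upwards [hc] with i hi
  rw [map_sub, map_mul, evalAt_const f (x i) (hpt i.1), evalAt_const f (x i) (hpt i.1)]
  exact sub_eq_zero.mpr hi
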